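/- Let $R$ be a commutative noetherian local ring with maximal ideal $\mathfrak{m}$, residue field $k=R/\mathfrak{m}$ and $\mathfrak{m}$-adic completion $\widehat R$. An $R$-module $M$ is mini-max if it has a noetherian submodule $N$ such that $M/N$ is artinian. A module $L$ over a commutative noetherian local ring $S$ with residue field $k_S$ is Matlis reflexive over $S$ if the natural biduality map $L\to\operatorname{Hom}_S(\operatorname{Hom}_S(L,E_S),E_S)$, $x\mapsto(\psi\mapsto\psi(x))$, is an isomorphism, where $E_S=E_S(k_S)$ is the injective hull of $k_S$ over $S$. Let $M$ and $M'$ be $R$-modules such that $M$ is mini-max and $M'$ is Matlis reflexive over $R$. Then for every integer $i\ge 0$ each of the $R$-modules $L=\operatorname{Ext}^i_R(M,M')$ and $L=\operatorname{Ext}^i_R(M',M)$ is Matlis reflexive over $R$. Moreover, $L$ has a unique $\widehat R$-module structure extending its $R$-module structure, and with this structure $L$ is Matlis reflexive over $\widehat R$. -/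

import Mathlib

universe u v w

namespace MatlisExt

/-- `ι : M → E` exhibits `E` as an injective hull of `M`: `E` is injective, `ι` is injective, and
the extension is essential (a submodule of `E` that meets the image of `M` trivially is zero). -/
structure IsInjectiveHull {R : Type u} [CommRing R] {M : Type v} {E : Type u} [AddCommGroup M]
    [Module R M] [AddCommGroup E] [Module R E] (ι : M →ₗ[R] E) : Prop where
  injective_module : Module.Injective R E
  injective_map : Function.Injective ι
  essential : ∀ K : Submodule R E, K ⊓ LinearMap.range ι = ⊥ → K = ⊥

/-- Every module has an injective hull. -/
theorem exists_isInjectiveHull (R : Type u) [CommRing R] (M : Type u) [AddCommGroup M]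
    [Module R M] : ∃ (E : ModuleCat.{u} R) (ι : M →ₗ[R] E), IsInjectiveHull ι := by
  -- embed `M` into an injective module `J`
  obtain ⟨P⟩ := CategoryTheory.EnoughInjectives.presentation (ModuleCat.of R M)
  let J := P.J
  let f : M →ₗ[R] J := P.f.hom
  have hf : Function.Injective f := (ModuleCat.mono_iff_injective P.f).mp P.mono
  have hJ : Module.Injective R J :=
    (Module.injective_iff_injective_object R J).mpr P.injective
  -- a maximal essential extension `E` of the image of `M` inside `J`
  let S : Set (Submodule R J) :=
    {N | LinearMap.range f ≤ N ∧ ∀ K ≤ N, K ⊓ LinearMap.range f = ⊥ → K = ⊥}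
  obtain ⟨E, -, hE⟩ := zorn_le_nonempty₀ S (fun c hc hchain N hN => by
    refine ⟨sSup c, ⟨(hc hN).1.trans (le_sSup hN), fun K hK hKM => ?_⟩, fun z hz => le_sSup hz⟩
    rw [Submodule.eq_bot_iff]
    intro x hx
    obtain ⟨N', hN', hxN'⟩ :=
      (Submodule.mem_sSup_of_directed ⟨N, hN⟩ hchain.directedOn).mp (hK hx)
    have hspan : Submodule.span R {x} = ⊥ :=
      (hc hN').2 _ ((Submodule.span_singleton_le_iff_mem _ _).mpr hxN')
        (eq_bot_iff.mpr ((inf_le_inf_right _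
          ((Submodule.span_singleton_le_iff_mem _ _).mpr hx)).trans hKM.le))
    exact Submodule.span_singleton_eq_bot.mp hspan)
    (LinearMap.range f) ⟨le_rfl, fun K hK hKM => by rwa [inf_eq_left.mpr hK] at hKM⟩
  -- a submodule `C` of `J` maximal among those meeting `E` trivially
  obtain ⟨C, -, hC⟩ := zorn_le_nonempty₀ {N : Submodule R J | N ⊓ E = ⊥}
    (fun c hc hchain N hN => by
      refine ⟨sSup c, ?_, fun z hz => le_sSup hz⟩
      rw [Set.mem_ofPred_eq, Submodule.eq_bot_iff]
      intro x hx
      obtain ⟨N', hN', hxN'⟩ :=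
        (Submodule.mem_sSup_of_directed ⟨N, hN⟩ hchain.directedOn).mp hx.1
      exact (Submodule.eq_bot_iff _).mp (hc hN') x ⟨hxN', hx.2⟩) ⊥ (by simp)
  -- extend the inclusion of `E` into `J` along `E → J ⧸ C`
  let q : E →ₗ[R] J ⧸ C := C.mkQ ∘ₗ E.subtype
  have hq : Function.Injective q := by
    rw [← LinearMap.ker_eq_bot, Submodule.eq_bot_iff]
    intro x hx
    have hxC : (x : J) ∈ C := by simpa [q] using hx
    have : (x : J) ∈ C ⊓ E := ⟨hxC, x.2⟩
    rw [hC.prop] at this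
    exact Subtype.ext (by simpa using this)
  obtain ⟨g, hg⟩ := hJ.out q hq E.subtype
  let p : J →ₗ[R] J := g ∘ₗ C.mkQ
  have hp : ∀ x ∈ E, p x = x := fun x hx => by
    simpa [p, q] using hg ⟨x, hx⟩
  have hpC : ∀ x ∈ C, p x = 0 := fun x hx => by
    have : C.mkQ x = 0 := by simpa using hx
    change g (C.mkQ x) = 0
    rw [this, map_zero]
  -- the image of the extension is an essential extension containing `E`, hence equals `E`
  have hrange : E ≤ LinearMap.range p := fun x hx => ⟨x, hp x hx⟩
  have hmem : LinearMap.range p ∈ S := by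
    refine ⟨hE.prop.1.trans hrange, fun K hK hKM => ?_⟩
    have hKE : K ⊓ E = ⊥ := hE.prop.2 _ inf_le_right
      (eq_bot_iff.mpr ((inf_le_inf_right _ inf_le_left).trans hKM.le))
    have hD : K.comap p ⊓ E = ⊥ := by
      rw [Submodule.eq_bot_iff]
      rintro x ⟨hxK, hxE⟩
      have : x ∈ K ⊓ E := ⟨by simpa [hp x hxE] using hxK, hxE⟩
      simpa [hKE] using this
    have hCD : C ≤ K.comap p := fun x hx => by simp [hpC x hx]
    have hDC : K.comap p ≤ C := hC.le_of_ge hD hCD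
    rw [Submodule.eq_bot_iff]
    intro x hx
    obtain ⟨y, rfl⟩ := hK hx
    exact hpC y (hDC hx)
  have hpE : ∀ x, p x ∈ E := fun x => hE.le_of_ge hmem hrange ⟨x, rfl⟩
  -- so `E` is a direct summand of `J`
  refine ⟨ModuleCat.of R E, f.codRestrict E (fun m => hE.prop.1 ⟨m, rfl⟩), ⟨?_, ?_, ?_⟩⟩
  · refine ⟨fun X Y _ _ _ _ i hi h => ?_⟩
    obtain ⟨k, hk⟩ := Module.Injective.out i hi (E.subtype ∘ₗ h)
    refine ⟨(p ∘ₗ k).codRestrict E (fun x => hpE _), fun x => Subtype.ext ?_⟩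
    change p (k (i x)) = (h x : J)
    rw [hk]
    exact hp _ (h x).2
  · exact fun a b hab => hf (congrArg Subtype.val hab)
  · intro K hK
    have hmap : K.map E.subtype = ⊥ := by
      refine hE.prop.2 _ (Submodule.map_subtype_le _ _) ?_
      rw [Submodule.eq_bot_iff]
      rintro _ ⟨⟨x, hx, rfl⟩, m, hm⟩
      have : x ∈ (⊥ : Submodule R E) := hK ▸ ⟨hx, m, Subtype.ext hm⟩
      rw [(Submodule.mem_bot R).mp this]
      rfl
    exact Submodule.map_injective_of_injective E.injective_subtype (hmap.trans (Submodule.map_bot _).symm)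

/-- The injective hull `E_R(M)` of an `R`-module `M` (well defined up to isomorphism). -/
noncomputable def injectiveHull (R : Type u) [CommRing R] (M : Type u) [AddCommGroup M]
    [Module R M] : ModuleCat.{u} R :=
  (exists_isInjectiveHull R M).choose

/-- The inclusion of `M` into its injective hull. -/
noncomputable def injectiveHullι (R : Type u) [CommRing R] (M : Type u) [AddCommGroup M]
    [Module R M] : M →ₗ[R] injectiveHull R M :=
  (exists_isInjectiveHull R M).choose_spec.choose

theorem isInjectiveHull_injectiveHullι (R : Type u) [CommRing R] (M : Type u) [AddCommGroup M]
    [Module R M] : IsInjectiveHull (injectiveHullι R M) :=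
  (exists_isInjectiveHull R M).choose_spec.choose_spec

/-- The biduality map `M → Hom_R(Hom_R(M, E), E)`, `x ↦ (ψ ↦ ψ x)`. -/
def biduality (R : Type u) [CommRing R] (M : Type v) [AddCommGroup M] [Module R M]
    (E : Type w) [AddCommGroup E] [Module R E] : M →ₗ[R] ((M →ₗ[R] E) →ₗ[R] E) where
  toFun x :=
    { toFun := fun ψ => ψ x
      map_add' := fun _ _ => rfl
      map_smul' := fun _ _ => rfl }
  map_add' x y := LinearMap.ext fun ψ => ψ.map_add x y
  map_smul' r x := LinearMap.ext fun ψ => ψ.map_smul r x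

/-- A module over a local ring `R` with residue field `k` is Matlis reflexive if its biduality map
with respect to `E = E_R(k)` is an isomorphism. -/
def IsMatlisReflexive (R : Type u) [CommRing R] [IsLocalRing R] (M : Type v) [AddCommGroup M]
    [Module R M] : Prop :=
  Function.Bijective (biduality R M (injectiveHull R (IsLocalRing.ResidueField R)))

/-- A module is mini-max if it has a noetherian submodule with artinian quotient. -/
def IsMinimax (R : Type u) [CommRing R] (M : Type v) [AddCommGroup M] [Module R M] : Prop :=
  ∃ N : Submodule R M, IsNoetherian R N ∧ IsArtinian R (M ⧸ N)

/-- The completion of a local ring with respect to its maximal ideal. -/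
abbrev Completion (R : Type u) [CommRing R] [IsLocalRing R] : Type u :=
  AdicCompletion (IsLocalRing.maximalIdeal R) R

/-- An `R`-module `L` is canonically a Matlis reflexive module over the completion `R̂`:
there is exactly one `R̂`-module structure on `L` extending its `R`-module structure,
and `L` with this structure is Matlis reflexive over `R̂`.

If `R ⧸ 𝔞` is complete, where `𝔞` is the annihilator of `L`, any such structure is given by
`r • x = r₀ • x` for `r : R̂` and `r₀ : R` with `r - r₀ ∈ 𝔞 R̂`. -/
def IsMatlisReflexiveOverCompletion (R : Type u) [CommRing R] [IsNoetherianRing R] [IsLocalRing R]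
    (L : Type v) [AddCommGroup L] [Module R L] : Prop :=
  (∃! _inst : Module (Completion R) L, IsScalarTower R (Completion R) L) ∧
    ∀ [Module (Completion R) L] [IsScalarTower R (Completion R) L],
      IsMatlisReflexive (Completion R) L

end MatlisExt

/-! Write E for the injective hull of k and D = Hom(-, E). Since E is an injective cogenerator, D is
exact and faithful, so reflexive modules are closed under submodules, quotients and extensions. The
proof rests on two facts. A reflexive module X is mini-max and R/Ann X is again reflexive
(`IsMatlisReflexive.isMinimax`, `IsMatlisReflexive.quotient_annihilator`). Conversely, a finite or
artinian module killed by an ideal I with R/I reflexive is reflexive (`IsMatlisReflexive.of_finite`,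
`IsMatlisReflexive.of_isArtinian`). Long exact sequences then reduce the claim to four cases, with X
reflexive, A artinian and N finite.

Ext(N, X): dimension shifting along free covers reduces to Hom(N, X), a submodule of a power of X.
Ext(X, A): dimension shifting along embeddings A ⊆ E^m reduces to Hom(X, A), a submodule of a power
of DX. Ext(A, X): as X = DDX, adjunction gives Ext(A, X) = D Tor(A, DX). Tor of an artinian and a
mini-max module is artinian, and here it is killed by Ann X, hence reflexive. Ext(X, N): cut X into
a finite and an artinian reflexive piece. The finite piece gives a finite Ext killed by its
annihilator. For an artinian reflexive A, Ext(A, N) embeds in Ext(A, DDN) = D Tor(A, DN), because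
Ext(A, DDN/N) = 0. That vanishing is proved for A = k by noetherian induction and carried over to
all modules torsion for powers of the maximal ideal.

For the completion, let I = Ann L. Reflexivity of R/I makes R → R̂/IR̂ surjective, which forces the
R̂-structure on L, and reflexivity is insensitive to surjective changes of local rings. -/

namespace MatlisExt

open IsLocalRing

/-- The injective hull of the residue field of a local ring. -/
abbrev MatlisModule (R : Type u) [CommRing R] [IsLocalRing R] : Type u :=
  injectiveHull R (ResidueField R)

/-- The Matlis dual of a module over a local ring. -/
abbrev MatlisDual (R : Type u) [CommRing R] [IsLocalRing R] (M : Type v) [AddCommGroup M]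
    [Module R M] : Type (max u v) :=
  M →ₗ[R] MatlisModule R

/-! ### Matlis duality: exactness and closure properties of reflexive modules -/

section Dual

variable {R : Type u} [CommRing R] [IsLocalRing R]
variable {A B C M : Type u} [AddCommGroup A] [Module R A] [AddCommGroup B] [Module R B]
  [AddCommGroup C] [Module R C] [AddCommGroup M] [Module R M]

instance injective_matlisModule : Module.Injective R (MatlisModule R) :=
  (isInjectiveHull_injectiveHullι R (ResidueField R)).injective_module

theorem exists_extend {f : A →ₗ[R] B} (hf : Function.Injective f)
    (φ : A →ₗ[R] MatlisModule R) : ∃ ψ : B →ₗ[R] MatlisModule R, ψ ∘ₗ f = φ := by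
  obtain ⟨ψ, h⟩ := Module.Injective.out f hf φ
  exact ⟨ψ, LinearMap.ext h⟩

/-- Rx = R/Ann(x) maps onto k because Ann(x) lies in the maximal ideal; compose with k ⊆ E and
extend to M by injectivity of E. -/
theorem exists_dual_ne_zero {x : M} (hx : x ≠ 0) : ∃ ψ : M →ₗ[R] MatlisModule R, ψ x ≠ 0 := by
  have hI : Ideal.torsionOf R M x ≤ maximalIdeal R := by
    refine le_maximalIdeal fun h => hx ?_
    rwa [Ideal.torsionOf_eq_top_iff] at h
  let ι := injectiveHullι R (ResidueField R)
  have hι : Function.Injective ι :=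
    (isInjectiveHull_injectiveHullι R (ResidueField R)).injective_map
  let q : (R ⧸ Ideal.torsionOf R M x) →ₗ[R] ResidueField R :=
    Submodule.liftQ _ (Algebra.linearMap R (ResidueField R)) (by
      intro r hr
      rw [LinearMap.mem_ker, Algebra.linearMap_apply]
      exact (IsLocalRing.residue_eq_zero_iff r).mpr (hI hr))
  let e := Ideal.quotTorsionOfEquivSpanSingleton R M x
  obtain ⟨ψ, hψ⟩ := exists_extend (Submodule.injective_subtype (Submodule.span R {x}))
    (ι ∘ₗ q ∘ₗ e.symm.toLinearMap)
  refine ⟨ψ, fun h => ?_⟩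
  have h1 := LinearMap.congr_fun hψ ⟨x, Submodule.mem_span_singleton_self x⟩
  have h2 : e (Ideal.Quotient.mk _ 1) = ⟨x, Submodule.mem_span_singleton_self x⟩ := by
    apply Subtype.ext
    have := Ideal.quotTorsionOfEquivSpanSingleton_apply_mk (R := R) (M := M) x 1
    rw [one_smul] at this
    exact congrArg Subtype.val this
  rw [← h2] at h1
  simp only [LinearMap.comp_apply, LinearEquiv.coe_coe, LinearEquiv.symm_apply_apply] at h1
  rw [h2] at h1
  change ψ x = ι (q (Ideal.Quotient.mk _ 1)) at h1
  rw [h] at h1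
  have h3 : q (Ideal.Quotient.mk _ 1) = 1 := by
    change (Algebra.linearMap R (ResidueField R)) 1 = 1
    simp
  rw [h3, eq_comm, map_eq_zero_iff ι hι] at h1
  exact one_ne_zero h1

theorem eq_zero_of_forall_dual {x : M} (h : ∀ ψ : M →ₗ[R] MatlisModule R, ψ x = 0) : x = 0 := by
  by_contra hx
  obtain ⟨ψ, hψ⟩ := exists_dual_ne_zero (R := R) hx
  exact hψ (h ψ)

theorem mem_of_forall_dual (N : Submodule R M) {x : M}
    (h : ∀ ψ : M →ₗ[R] MatlisModule R, (∀ y ∈ N, ψ y = 0) → ψ x = 0) : x ∈ N := by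
  rw [← Submodule.Quotient.mk_eq_zero]
  refine eq_zero_of_forall_dual (R := R) fun ψ => ?_
  exact h (ψ ∘ₗ N.mkQ) fun y hy => by
    rw [LinearMap.comp_apply, Submodule.mkQ_apply, (Submodule.Quotient.mk_eq_zero N).mpr hy,
      map_zero]

theorem biduality_injective : Function.Injective (biduality R M (MatlisModule R)) := by
  rw [injective_iff_map_eq_zero]
  exact fun x hx => eq_zero_of_forall_dual (R := R) fun ψ => LinearMap.congr_fun hx ψ

theorem isMatlisReflexive_iff :
    IsMatlisReflexive R M ↔ ∀ Φ : MatlisDual R (MatlisDual R M), ∃ x, ∀ ψ, Φ ψ = ψ x := by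
  constructor
  · intro h Φ
    obtain ⟨x, hx⟩ := h.2 Φ
    exact ⟨x, fun ψ => (LinearMap.congr_fun hx ψ).symm⟩
  · intro h
    refine ⟨biduality_injective, fun Φ => ?_⟩
    obtain ⟨x, hx⟩ := h Φ
    exact ⟨x, LinearMap.ext fun ψ => (hx ψ).symm⟩

/-- The map induced by `f` on Matlis duals. -/
noncomputable abbrev dualMap (f : A →ₗ[R] B) : MatlisDual R B →ₗ[R] MatlisDual R A :=
  LinearMap.lcomp R (MatlisModule R) f

theorem dualMap_surjective {f : A →ₗ[R] B} (hf : Function.Injective f) :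
    Function.Surjective (dualMap f) := fun φ => exists_extend hf φ

theorem dualMap_injective {g : B →ₗ[R] C} (hg : Function.Surjective g) :
    Function.Injective (dualMap g) := fun φ ψ h => LinearMap.ext fun c => by
  obtain ⟨b, rfl⟩ := hg c
  exact LinearMap.congr_fun h b

theorem dualMap_exact {f : A →ₗ[R] B} {g : B →ₗ[R] C} (h : Function.Exact f g) :
    Function.Exact (dualMap g) (dualMap f) := by
  intro φ
  constructor
  · intro hφ
    have hker : LinearMap.ker g ≤ LinearMap.ker φ := fun x hx => by
      obtain ⟨a, rfl⟩ := (h x).mp hx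
      exact LinearMap.congr_fun hφ a
    obtain ⟨ψ, hψ⟩ := exists_extend
      (f := (LinearMap.ker g).liftQ g le_rfl)
      (by rw [← LinearMap.ker_eq_bot, Submodule.ker_liftQ_eq_bot _ _ _ le_rfl])
      ((LinearMap.ker g).liftQ φ hker)
    exact ⟨ψ, LinearMap.ext fun b => LinearMap.congr_fun hψ (Submodule.Quotient.mk b)⟩
  · rintro ⟨ψ, rfl⟩
    refine LinearMap.ext fun a => ?_
    change ψ (g (f a)) = 0
    rw [h.apply_apply_eq_zero, map_zero]

/-- Φ sees a functional on B only through its restriction along f, so every functional vanishing on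
the range of f kills b; E separates points of the cokernel. This drives closure under submodules and
extensions. -/
theorem mem_range_of_dualMap_dualMap_eq {f : A →ₗ[R] B} {Φ : MatlisDual R (MatlisDual R A)} {b : B}
    (h : dualMap (dualMap f) Φ = biduality R B (MatlisModule R) b) : b ∈ LinearMap.range f :=
  mem_of_forall_dual (R := R) _ fun ψ hψ => by
    have h1 : Φ (dualMap f ψ) = ψ b := LinearMap.congr_fun h ψ
    have h2 : dualMap f ψ = 0 := LinearMap.ext fun a => hψ _ ⟨a, rfl⟩
    rw [← h1, h2, map_zero]

theorem dualMap_dualMap_biduality (f : A →ₗ[R] B) (a : A) :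
    dualMap (dualMap f) (biduality R A (MatlisModule R) a) =
      biduality R B (MatlisModule R) (f a) :=
  rfl

theorem IsMatlisReflexive.of_injective (hB : IsMatlisReflexive R B) (f : A →ₗ[R] B)
    (hf : Function.Injective f) : IsMatlisReflexive R A := by
  refine ⟨biduality_injective, fun Φ => ?_⟩
  obtain ⟨b, hb⟩ := hB.2 (dualMap (dualMap f) Φ)
  obtain ⟨a, rfl⟩ := mem_range_of_dualMap_dualMap_eq hb.symm
  exact ⟨a, dualMap_injective (dualMap_surjective hf) hb⟩

theorem IsMatlisReflexive.of_surjective (hB : IsMatlisReflexive R B) (g : B →ₗ[R] C)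
    (hg : Function.Surjective g) : IsMatlisReflexive R C := by
  refine ⟨biduality_injective, fun Φ => ?_⟩
  obtain ⟨Ψ, rfl⟩ := dualMap_surjective (dualMap_injective hg) Φ
  obtain ⟨b, rfl⟩ := hB.2 Ψ
  exact ⟨g b, rfl⟩

/-- A four-lemma chase in the double dual. Exactness in the middle is enough, so the lemma applies
directly to terms of long exact sequences. -/
theorem IsMatlisReflexive.of_exact (f : A →ₗ[R] B) (g : B →ₗ[R] C)
    (hfg : Function.Exact f g) (hA : IsMatlisReflexive R A) (hC : IsMatlisReflexive R C) :
    IsMatlisReflexive R B := by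
  refine ⟨biduality_injective, fun Φ => ?_⟩
  obtain ⟨c, hc⟩ := hC.2 (dualMap (dualMap g) Φ)
  obtain ⟨b, rfl⟩ := mem_range_of_dualMap_dualMap_eq hc.symm
  have h0 : dualMap (dualMap g) (Φ - biduality R B (MatlisModule R) b) = 0 := by
    rw [map_sub, dualMap_dualMap_biduality, hc, sub_self]
  obtain ⟨Θ, hΘ⟩ := (dualMap_exact (dualMap_exact hfg) _).mp h0
  obtain ⟨a, rfl⟩ := hA.2 Θ
  refine ⟨b + f a, ?_⟩
  rw [map_add, ← dualMap_dualMap_biduality f, hΘ, add_sub_cancel]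

theorem IsMatlisReflexive.of_equiv (hA : IsMatlisReflexive R A) (e : A ≃ₗ[R] B) :
    IsMatlisReflexive R B :=
  hA.of_surjective e.toLinearMap e.surjective

theorem IsMatlisReflexive.of_subsingleton [Subsingleton M] : IsMatlisReflexive R M :=
  isMatlisReflexive_iff.mpr fun Φ => ⟨0, fun ψ => by
    rw [Subsingleton.elim ψ 0, map_zero, LinearMap.zero_apply]⟩

theorem IsMatlisReflexive.prod (hA : IsMatlisReflexive R A) (hB : IsMatlisReflexive R B) :
    IsMatlisReflexive R (A × B) :=
  .of_exact (LinearMap.inl R A B) (LinearMap.snd R A B) Function.Exact.inl_snd hA hB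

theorem IsMatlisReflexive.fin (hA : IsMatlisReflexive R A) (n : ℕ) :
    IsMatlisReflexive R (Fin n → A) := by
  induction n with
  | zero => exact .of_subsingleton
  | succ n ih => exact (hA.prod ih).of_equiv (Fin.consLinearEquiv R fun _ => A)

theorem IsMatlisReflexive.dual (hM : IsMatlisReflexive R M) :
    IsMatlisReflexive R (MatlisDual R M) := by
  rw [isMatlisReflexive_iff]
  refine fun Φ => ⟨Φ ∘ₗ biduality R M (MatlisModule R), fun Θ => ?_⟩
  obtain ⟨x, rfl⟩ := hM.2 Θ
  rfl

end Dual

end MatlisExt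

namespace MatlisExt

open IsLocalRing

/-! ### Injective hulls and reflexivity along surjections of local rings -/

section Quotient

/-- The module structure over `S` on an `R`-module killed by the kernel of a surjective
ring homomorphism `R → S`. -/
@[reducible]
noncomputable def moduleOfSurjective {R S : Type u} [CommRing R] [CommRing S] [Algebra R S]
    (hS : Function.Surjective (algebraMap R S)) (T : Type v) [AddCommGroup T] [Module R T]
    (hT : ∀ r : R, algebraMap R S r = 0 → ∀ t : T, r • t = 0) : Module S T :=
  Module.compHom T ((algebraMap R S).liftOfSurjective hS
    ⟨algebraMap R (Module.End R T), fun r hr => LinearMap.ext fun t => hT r hr t⟩)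

theorem moduleOfSurjective_isScalarTower {R S : Type u} [CommRing R] [CommRing S] [Algebra R S]
    (hS : Function.Surjective (algebraMap R S)) (T : Type v) [AddCommGroup T] [Module R T]
    (hT : ∀ r : R, algebraMap R S r = 0 → ∀ t : T, r • t = 0) :
    letI := moduleOfSurjective hS T hT
    IsScalarTower R S T := by
  let := moduleOfSurjective hS T hT
  refine IsScalarTower.of_algebraMap_smul fun r x => ?_
  change ((algebraMap R S).liftOfSurjective hS
    ⟨algebraMap R (Module.End R T), fun r hr => LinearMap.ext fun t => hT r hr t⟩)
    (algebraMap R S r) x = r • x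
  rw [RingHom.liftOfSurjective, RingHom.liftOfRightInverse_comp_apply]
  rfl

/-- The image of `1` in the injective hull of the residue field. -/
noncomputable def hullOne (R : Type u) [CommRing R] [IsLocalRing R] : MatlisModule R :=
  injectiveHullι R (ResidueField R) 1

theorem hullOne_ne_zero (R : Type u) [CommRing R] [IsLocalRing R] : hullOne R ≠ 0 := fun h =>
  one_ne_zero ((map_eq_zero_iff _ (isInjectiveHull_injectiveHullι R
    (ResidueField R)).injective_map).mp h)

/-- By essentiality K meets the copy of k nontrivially; that copy is one-dimensional, so K contains
all of it. Thus `hullOne R` lies in every nonzero submodule of E. -/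
theorem hullOne_mem {R : Type u} [CommRing R] [IsLocalRing R] {K : Submodule R (MatlisModule R)}
    (hK : K ≠ ⊥) : hullOne R ∈ K := by
  have h := mt ((isInjectiveHull_injectiveHullι R (ResidueField R)).essential K) hK
  obtain ⟨y, ⟨hy, c, rfl⟩, h0⟩ := Submodule.exists_mem_ne_zero_of_ne_bot h
  have hc : c ≠ 0 := fun h => h0 (by rw [h, map_zero])
  obtain ⟨r, hr⟩ := residue_surjective (c⁻¹)
  have : hullOne R = r • injectiveHullι R (ResidueField R) c := by
    rw [← map_smul, Algebra.smul_def, ResidueField.algebraMap_eq, hr, inv_mul_cancel₀ hc, hullOne]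
  rw [this]
  exact K.smul_mem _ hy

/-- E_S is the part T of E_R killed by the kernel of R → S. A functional j on E_S that is nonzero at
`hullOne S` is injective, as its kernel is an S-submodule. Its image in T splits off by injectivity
of E_S over S; the complementary summand vanishes, since otherwise it would share `hullOne R` with
the image of j. -/
theorem exists_hull_comparison (R S : Type u) [CommRing R] [IsLocalRing R] [CommRing S]
    [IsLocalRing S] [Algebra R S] (hS : Function.Surjective (algebraMap R S)) :
    ∃ j : MatlisModule S →+ MatlisModule R, Function.Injective j ∧
      (∀ (r : R) e, j (algebraMap R S r • e) = r • j e) ∧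
      ∀ t, (∀ r, algebraMap R S r = 0 → r • t = 0) → ∃ e, j e = t := by
  let : Module R (MatlisModule S) := Module.compHom _ (algebraMap R S)
  have : IsScalarTower R S (MatlisModule S) :=
    IsScalarTower.of_algebraMap_smul fun r x => rfl
  obtain ⟨j, hj⟩ := exists_dual_ne_zero (R := R) (hullOne_ne_zero S)
  have hinj : Function.Injective j := by
    rw [← LinearMap.ker_eq_bot]
    by_contra hne
    let K : Submodule S (MatlisModule S) :=
      { (LinearMap.ker j) with
        smul_mem' := fun s x hx => by
          obtain ⟨r, rfl⟩ := hS s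
          rw [algebraMap_smul]
          exact (LinearMap.ker j).smul_mem r hx }
    have hK : K ≠ ⊥ := fun h => hne (by
      rw [Submodule.eq_bot_iff]
      intro x hx
      have : x ∈ K := hx
      rwa [h, Submodule.mem_bot] at this)
    exact hj (show hullOne S ∈ LinearMap.ker j from hullOne_mem hK)
  refine ⟨j.toAddMonoidHom, hinj, fun r e => by
    change j (algebraMap R S r • e) = r • j e
    rw [algebraMap_smul, map_smul], ?_⟩
  let T : Submodule R (MatlisModule R) :=
    { carrier := {t | ∀ r, algebraMap R S r = 0 → r • t = 0}
      add_mem' := fun {a b} ha hb r hr => by rw [smul_add, ha r hr, hb r hr, add_zero]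
      zero_mem' := fun r _ => smul_zero r
      smul_mem' := fun c x hx r hr => by rw [smul_comm, hx r hr, smul_zero] }
  have hT : ∀ r : R, algebraMap R S r = 0 → ∀ t : T, r • t = 0 := fun r hr t =>
    Subtype.ext (t.2 r hr)
  let := moduleOfSurjective hS T hT
  have : IsScalarTower R S T := moduleOfSurjective_isScalarTower hS T hT
  have hjT : ∀ e, j e ∈ T := fun e r hr => by
    rw [← map_smul, ← algebraMap_smul S, hr, zero_smul, map_zero]
  let jT : MatlisModule S →ₗ[S] T :=
    LinearMap.extendScalarsOfSurjective hS (j.codRestrict T hjT)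
  have hjT' : ∀ e, (jT e : MatlisModule R) = j e := fun _ => rfl
  have hjinj : Function.Injective jT := fun a b hab => hinj (congrArg Subtype.val hab)
  obtain ⟨p, hp⟩ := exists_extend hjinj LinearMap.id
  have hker : ∀ t : T, p t = 0 → t = 0 := by
    by_contra! hne
    obtain ⟨t, ht, ht0⟩ := hne
    let K : Submodule R (MatlisModule R) :=
      (LinearMap.ker (p.restrictScalars R)).map T.subtype
    have hK : K ≠ ⊥ := fun h => ht0 (Subtype.ext (by
      have : (t : MatlisModule R) ∈ K := ⟨t, ht, rfl⟩
      rwa [h, Submodule.mem_bot] at this))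
    have hr : LinearMap.range j ≠ ⊥ := fun h => hj (by
      have : j (hullOne S) ∈ LinearMap.range j := ⟨_, rfl⟩
      rwa [h, Submodule.mem_bot] at this)
    obtain ⟨t', ht', h1⟩ := hullOne_mem hK
    obtain ⟨e, he⟩ := hullOne_mem hr
    have h2 : t' = jT e := Subtype.ext (h1.trans he.symm)
    have h3 : p (jT e) = e := LinearMap.congr_fun hp e
    have h4 : p t' = 0 := ht'
    rw [h2, h3] at h4
    rw [h4, map_zero] at he
    exact hullOne_ne_zero R he.symm
  intro t ht
  refine ⟨p ⟨t, ht⟩, ?_⟩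
  have h1 : jT (p ⟨t, ht⟩) - ⟨t, ht⟩ = 0 := hker _ (by
    have : p (jT (p ⟨t, ht⟩)) = p ⟨t, ht⟩ := LinearMap.congr_fun hp _
    rw [map_sub, this, sub_self])
  exact congrArg Subtype.val (sub_eq_zero.mp h1)

/-- A functional from L to E_R takes values killed by the kernel of R → S, that is, in E_S. Hence
`up` identifies the two duals of L, and likewise the two biduals. -/
theorem isMatlisReflexive_iff_of_surjective {R S : Type u} [CommRing R] [IsLocalRing R]
    [CommRing S] [IsLocalRing S] [Algebra R S] (hS : Function.Surjective (algebraMap R S))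
    (L : Type u) [AddCommGroup L] [Module R L] [Module S L] [IsScalarTower R S L] :
    IsMatlisReflexive R L ↔ IsMatlisReflexive S L := by
  obtain ⟨j, hinj, hlin, hsurj⟩ := exists_hull_comparison R S hS
  have hkill : ∀ r : R, algebraMap R S r = 0 → ∀ x : L, r • x = 0 := fun r hr x => by
    rw [← algebraMap_smul S, hr, zero_smul]
  let up : MatlisDual S L → MatlisDual R L := fun f =>
    { toFun := fun x => j (f x)
      map_add' := fun x y => by rw [map_add, map_add]
      map_smul' := fun r x => by
        rw [← algebraMap_smul S, map_smul, hlin, RingHom.id_apply] }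
  have hup : ∀ g : MatlisDual R L, ∃ f, up f = g := fun g => by
    choose f hf using fun x => hsurj (g x) fun r hr => by
      rw [← map_smul, hkill r hr, map_zero]
    refine ⟨{ toFun := f, map_add' := fun x y => hinj ?_, map_smul' := fun s x => hinj ?_ },
      LinearMap.ext hf⟩
    · rw [map_add, hf, hf, hf, map_add]
    · obtain ⟨r, rfl⟩ := hS s
      rw [RingHom.id_apply, hlin, hf, hf, algebraMap_smul, map_smul]
  have hupinj : Function.Injective up := fun f f' h => LinearMap.ext fun x =>
    hinj (LinearMap.congr_fun h x)
  choose dn hdn using hup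
  have hup_add : ∀ f f', up (f + f') = up f + up f' := fun f f' => LinearMap.ext fun x =>
    map_add j _ _
  have hup_smul : ∀ (r : R) f, up (algebraMap R S r • f) = r • up f := fun r f =>
    LinearMap.ext fun x => hlin r _
  rw [isMatlisReflexive_iff, isMatlisReflexive_iff]
  constructor
  · intro h Φ
    obtain ⟨x, hx⟩ := h
      { toFun := fun g => j (Φ (dn g))
        map_add' := fun g g' => by
          rw [← map_add, ← map_add]
          congr 2
          apply hupinj
          rw [hup_add, hdn, hdn, hdn]
        map_smul' := fun r g => by
          rw [RingHom.id_apply, ← hlin, ← map_smul]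
          congr 2
          apply hupinj
          rw [hup_smul, hdn, hdn] }
    refine ⟨x, fun f => hinj ?_⟩
    have h1 : j (Φ (dn (up f))) = up f x := hx (up f)
    rwa [hupinj (hdn (up f))] at h1
  · intro h Φ
    choose Ψ hΨ using fun f : MatlisDual S L => hsurj (Φ (up f)) fun r hr => by
      rw [← map_smul, ← hup_smul, hr, zero_smul]
      convert map_zero Φ
      exact LinearMap.ext fun x => map_zero j
    obtain ⟨x, hx⟩ := h
      { toFun := Ψ
        map_add' := fun f f' => hinj (by
          rw [map_add, hΨ, hΨ, hΨ, hup_add, map_add])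
        map_smul' := fun s f => hinj (by
          obtain ⟨r, rfl⟩ := hS s
          rw [RingHom.id_apply, hlin, hΨ, hΨ, hup_smul, map_smul]) }
    refine ⟨x, fun g => ?_⟩
    rw [← hdn g, ← hΨ]
    exact congrArg j (hx (dn g))

end Quotient

/-! ### Reflexive modules killed by the maximal ideal -/

section ResidueField

variable {R : Type u} [CommRing R] [IsLocalRing R]

theorem exists_matlisModule_equiv_self (k : Type u) [Field k] :
    Nonempty (MatlisModule k ≃ₗ[k] k) := by
  obtain ⟨K, hK⟩ := Submodule.exists_isCompl (Submodule.span k {hullOne k})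
  have hbot : K = ⊥ := by
    by_contra hne
    have h1 : hullOne k ∈ Submodule.span k {hullOne k} ⊓ K :=
      ⟨Submodule.mem_span_singleton_self _, hullOne_mem hne⟩
    rw [hK.inf_eq_bot, Submodule.mem_bot] at h1
    exact hullOne_ne_zero k h1
  have htop : Submodule.span k {hullOne k} = ⊤ := by
    rw [← hK.sup_eq_top, hbot, sup_bot_eq]
  exact ⟨(LinearEquiv.toSpanNonzeroSingleton k _ _ (hullOne_ne_zero k) ≪≫ₗ
    LinearEquiv.ofEq _ _ htop ≪≫ₗ Submodule.topEquiv).symm⟩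

theorem isMatlisReflexive_field_iff (k : Type u) [Field k] (V : Type u) [AddCommGroup V]
    [Module k V] : IsMatlisReflexive k V ↔ FiniteDimensional k V := by
  obtain ⟨e⟩ := exists_matlisModule_equiv_self k
  constructor
  · intro h
    have : Module.IsReflexive k V := by
      refine ⟨Module.eval_apply_injective k, fun Φ => ?_⟩
      obtain ⟨x, hx⟩ := isMatlisReflexive_iff.mp h
        (e.symm.toLinearMap ∘ₗ Φ ∘ₗ LinearMap.compRight k e.toLinearMap)
      refine ⟨x, LinearMap.ext fun ψ => ?_⟩
      have h1 := congrArg e (hx (e.symm.toLinearMap ∘ₗ ψ))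
      have h2 : LinearMap.compRight k e.toLinearMap (e.symm.toLinearMap ∘ₗ ψ) = ψ :=
        LinearMap.ext fun y => e.apply_symm_apply _
      simp only [LinearMap.comp_apply, h2, LinearEquiv.coe_coe, e.apply_symm_apply] at h1
      exact h1.symm
    -- Over a field, a space that equals its bidual is finite-dimensional.
    infer_instance
  · intro h
    rw [isMatlisReflexive_iff]
    intro Φ
    obtain ⟨x, hx⟩ := (Module.bijective_dual_eval k V).2
      (e.toLinearMap ∘ₗ Φ ∘ₗ LinearMap.compRight k e.symm.toLinearMap)
    refine ⟨x, fun ψ => e.injective ?_⟩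
    have h1 := LinearMap.congr_fun hx (e.toLinearMap ∘ₗ ψ)
    have h2 : LinearMap.compRight k e.symm.toLinearMap (e.toLinearMap ∘ₗ ψ) = ψ :=
      LinearMap.ext fun y => e.symm_apply_apply _
    simp only [LinearMap.comp_apply, h2] at h1
    exact h1.symm

/-- The source of all finiteness below: every subquotient of a reflexive module that is a k-vector
space is finite-dimensional. -/
theorem isMatlisReflexive_iff_finite {V : Type u} [AddCommGroup V] [Module R V]
    (hV : ∀ r ∈ maximalIdeal R, ∀ x : V, r • x = 0) :
    IsMatlisReflexive R V ↔ Module.Finite R V := by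
  have hS : Function.Surjective (algebraMap R (ResidueField R)) := residue_surjective
  have hT : ∀ r : R, algebraMap R (ResidueField R) r = 0 → ∀ t : V, r • t = 0 := fun r hr =>
    hV r ((residue_eq_zero_iff r).mp hr)
  let := moduleOfSurjective hS V hT
  have := moduleOfSurjective_isScalarTower hS V hT
  rw [isMatlisReflexive_iff_of_surjective hS V, isMatlisReflexive_field_iff]
  refine ⟨fun h => ?_, fun h => Module.Finite.of_restrictScalars_finite R _ V⟩
  have : Module.Finite R (ResidueField R) := Module.Finite.of_surjective
    (Algebra.linearMap R (ResidueField R)) hS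
  exact Module.Finite.trans (ResidueField R) V

end ResidueField

end MatlisExt

namespace MatlisExt

open IsLocalRing

/-! ### Torsion modules with artinian socle are artinian -/

section Artinian

variable {R : Type u} [CommRing R]

/-- Every element is killed by a power of the ideal `I`. -/
def IsPowerTorsion (I : Ideal R) (M : Type v) [AddCommGroup M] [Module R M] : Prop :=
  ∀ x : M, ∃ n : ℕ, ∀ r ∈ I ^ n, r • x = 0

theorem IsPowerTorsion.of_injective {I : Ideal R} {M N : Type*} [AddCommGroup M] [Module R M]
    [AddCommGroup N] [Module R N] (hN : IsPowerTorsion I N) (f : M →ₗ[R] N)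
    (hf : Function.Injective f) : IsPowerTorsion I M := fun x => by
  obtain ⟨n, hn⟩ := hN (f x)
  exact ⟨n, fun r hr => hf (by rw [map_smul, hn r hr, map_zero])⟩

theorem IsPowerTorsion.fin {I : Ideal R} {M : Type*} [AddCommGroup M] [Module R M]
    (hM : IsPowerTorsion I M) (n : ℕ) : IsPowerTorsion I (Fin n → M) := fun x => by
  choose k hk using fun i => hM (x i)
  refine ⟨Finset.univ.sup k, fun r hr => funext fun i => ?_⟩
  exact hk i r (Ideal.pow_le_pow_right (Finset.le_sup (Finset.mem_univ i)) hr)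

variable {M : Type v} [AddCommGroup M] [Module R M]

theorem exists_stable_of_antitone (T : Submodule R M) [IsArtinian R T] (G : ℕ → Submodule R M)
    (hG : Antitone G) (hGT : ∀ n, G n ≤ T) : ∃ n₀, ∀ n, n₀ ≤ n → G n = G n₀ := by
  obtain ⟨n₀, h⟩ := IsArtinian.monotone_stabilizes (R := R) (M := T)
    ⟨fun n => OrderDual.toDual ((G n).comap T.subtype),
      fun a b hab => Submodule.comap_mono (hG hab)⟩
  refine ⟨n₀, fun n hn => ?_⟩
  have h1 : (G n₀).comap T.subtype = (G n).comap T.subtype := h n hn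
  have h2 := congrArg (Submodule.map T.subtype) h1
  rwa [Submodule.map_comap_subtype, Submodule.map_comap_subtype, inf_eq_right.mpr (hGT _),
    inf_eq_right.mpr (hGT _), eq_comm] at h2

/-- The elements `x ^ n • y` with `y ∈ N` that are killed by `x`. -/
def leadingPart (x : R) (N : Submodule R M) (n : ℕ) : Submodule R M :=
  N.map (LinearMap.lsmul R M (x ^ n)) ⊓ Submodule.torsionBy R M x

theorem leadingPart_mono (x : R) {N N' : Submodule R M} (h : N ≤ N') {n n' : ℕ} (hn : n' ≤ n) :
    leadingPart x N n ≤ leadingPart x N' n' := by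
  rintro _ ⟨⟨y, hy, rfl⟩, ht⟩
  refine ⟨⟨x ^ (n - n') • y, N'.smul_mem _ (h hy), ?_⟩, ht⟩
  rw [LinearMap.lsmul_apply, LinearMap.lsmul_apply, smul_smul, ← pow_add, Nat.add_sub_cancel' hn]

/-- Induction on the exponent killing y: if x^(n+1) y = 0, then x^n y is a leading term, so x^n y =
x^n z for some z in N', and y - z is killed by x^n. -/
theorem le_of_leadingPart_le (x : R) (hx : ∀ y : M, ∃ n : ℕ, x ^ n • y = 0)
    {N N' : Submodule R M} (h : N' ≤ N) (hl : ∀ n, leadingPart x N n ≤ leadingPart x N' n) :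
    N ≤ N' := by
  have key : ∀ n : ℕ, ∀ y ∈ N, x ^ n • y = 0 → y ∈ N' := by
    intro n
    induction n with
    | zero => exact fun y _ h0 => by rw [pow_zero, one_smul] at h0; rw [h0]; exact zero_mem _
    | succ n ih =>
      intro y hy h0
      obtain ⟨⟨z, hz, hzy⟩, -⟩ := hl n (x := x ^ n • y) ⟨⟨y, hy, rfl⟩, by
        rw [SetLike.mem_coe, Submodule.mem_torsionBy_iff, smul_smul, ← pow_succ', h0]⟩
      have hzy' : x ^ n • z = x ^ n • y := hzy
      have := ih (y - z) (N.sub_mem hy (h hz)) (by rw [smul_sub, hzy', sub_self])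
      have h2 := N'.add_mem this hz
      rwa [sub_add_cancel] at h2
  intro y hy
  obtain ⟨n, hn⟩ := hx y
  exact key n y hy hn

/-- For a descending chain X_j, the leading parts of X_j in degree n decrease in both j and n inside
the artinian x-torsion. Stability of the diagonal from n₀ on controls all degrees n ≥ n₀; the
finitely many smaller degrees stabilise one by one. Equal leading parts force equal submodules. -/
theorem isArtinian_of_torsionBy (x : R) (hx : ∀ y : M, ∃ n : ℕ, x ^ n • y = 0)
    [IsArtinian R (Submodule.torsionBy R M x)] : IsArtinian R M := by
  rw [← monotone_stabilizes_iff_artinian]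
  intro f
  let X : ℕ → Submodule R M := fun n => OrderDual.ofDual (f n)
  have hX : Antitone X := fun a b hab => f.monotone hab
  have hstab := fun G => exists_stable_of_antitone (Submodule.torsionBy R M x) G
  obtain ⟨n₀, hn₀⟩ := hstab (fun j => leadingPart x (X j) j)
    (fun a b hab => leadingPart_mono x (hX hab) hab) (fun n => inf_le_right)
  choose k hk using fun n => hstab (fun j => leadingPart x (X j) n)
    (fun a b hab => leadingPart_mono x (hX hab) le_rfl) (fun n => inf_le_right)
  let J := max n₀ ((Finset.range n₀).sup k)
  refine ⟨J, fun j hj => ?_⟩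
  have hle : X j ≤ X J := hX hj
  refine le_antisymm ?_ (f.monotone hj) |>.symm
  change X J ≤ X j
  refine le_of_leadingPart_le x hx hle fun n => ?_
  by_cases hn : n < n₀
  · have h1 : k n ≤ J := (Finset.le_sup (Finset.mem_range.mpr hn)).trans (le_max_right _ _)
    exact ((hk n J h1).trans (hk n j (h1.trans hj)).symm).le
  · have hn' : n₀ ≤ n := not_lt.mp hn
    calc leadingPart x (X J) n ≤ leadingPart x (X n₀) n₀ :=
          leadingPart_mono x (hX (le_max_left _ _)) hn'
      _ = leadingPart x (X (max n j)) (max n j) := (hn₀ _ (hn'.trans (le_max_left _ _))).symm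
      _ ≤ leadingPart x (X j) n := leadingPart_mono x (hX (le_max_right _ _)) (le_max_left _ _)

theorem isArtinian_of_torsionBySet_finset (s : Finset R)
    (hs : ∀ x ∈ s, ∀ y : M, ∃ n : ℕ, x ^ n • y = 0)
    (h : IsArtinian R (Submodule.torsionBySet R M (s : Set R))) : IsArtinian R M := by
  classical
  induction s using Finset.induction_on with
  | empty =>
    refine isArtinian_of_injective (P := Submodule.torsionBySet R M ((∅ : Finset R) : Set R))
      (LinearMap.id.codRestrict _ fun m => ?_) (fun a b hab => congrArg Subtype.val hab)
    rw [Submodule.mem_torsionBySet_iff]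
    rintro ⟨a, ha⟩
    simp at ha
  | insert a s _ ih =>
    refine ih (fun x hx => hs x (Finset.mem_insert_of_mem hx)) ?_
    let T := Submodule.torsionBySet R M (s : Set R)
    have : IsArtinian R (Submodule.torsionBy R T a) := by
      refine isArtinian_of_injective
        (P := Submodule.torsionBySet R M ((insert a s : Finset R) : Set R))
        ((T.subtype ∘ₗ Submodule.subtype _).codRestrict _ fun m => ?_)
        (fun b c hbc => ?_)
      swap
      · have h1 : ((b : T) : M) = ((c : T) : M) := by
          have h0 := congrArg Subtype.val hbc
          exact h0
        exact Subtype.ext (Subtype.ext h1)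
      rw [Submodule.mem_torsionBySet_iff]
      rintro ⟨b, hb⟩
      rcases Finset.mem_insert.mp (Finset.mem_coe.mp hb) with rfl | hb
      · exact congrArg Subtype.val ((Submodule.mem_torsionBy_iff _ _).mp m.2)
      · exact (Submodule.mem_torsionBySet_iff _ _).mp m.1.2 ⟨b, hb⟩
    refine isArtinian_of_torsionBy a fun y => ?_
    obtain ⟨n, hn⟩ := hs a (Finset.mem_insert_self _ _) y
    exact ⟨n, Subtype.ext hn⟩

theorem isArtinian_of_isPowerTorsion [IsNoetherianRing R] (I : Ideal R) (hM : IsPowerTorsion I M)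
    (h : IsArtinian R (Submodule.torsionBySet R M (I : Set R))) : IsArtinian R M := by
  obtain ⟨s, rfl⟩ := (isNoetherianRing_iff_ideal_fg R).mp ‹_› I
  refine isArtinian_of_torsionBySet_finset s (fun x hx y => ?_) ?_
  · obtain ⟨n, hn⟩ := hM y
    exact ⟨n, hn _ (Ideal.pow_mem_pow (Submodule.subset_span hx) n)⟩
  · rwa [Submodule.torsionBySet_eq_torsionBySet_span]

variable [IsLocalRing R]

theorem finite_iff_isArtinian_of_smul_eq_zero
    (hM : ∀ r ∈ maximalIdeal R, ∀ x : M, r • x = 0) : Module.Finite R M ↔ IsArtinian R M := by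
  have hS : Function.Surjective (algebraMap R (ResidueField R)) := residue_surjective
  have hT : ∀ r : R, algebraMap R (ResidueField R) r = 0 → ∀ t : M, r • t = 0 := fun r hr =>
    hM r ((residue_eq_zero_iff r).mp hr)
  let := moduleOfSurjective hS M hT
  have := moduleOfSurjective_isScalarTower hS M hT
  have htfae := (IsArtinianRing.tfae (ResidueField R) M).out 0 2
  constructor
  · intro h
    have : IsArtinian (ResidueField R) M :=
      htfae.mp (Module.Finite.of_restrictScalars_finite R _ M)
    exact isArtinian_of_surjective_algebraMap hS
  · intro h
    have : Module.Finite (ResidueField R) M := htfae.mpr (isArtinian_of_tower R h)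
    have : Module.Finite R (ResidueField R) := Module.Finite.of_surjective
      (Algebra.linearMap R (ResidueField R)) hS
    exact Module.Finite.trans (ResidueField R) M

end Artinian

/-! ### E is artinian and cogenerates the artinian modules -/

section Local

variable {R : Type u} [CommRing R] [IsNoetherianRing R] [IsLocalRing R]

/-- If no power of the maximal ideal killed e, each of its multiples of Re would be nonzero and so
contain `hullOne R`, against Krull's intersection theorem in Re. -/
theorem isPowerTorsion_matlisModule : IsPowerTorsion (maximalIdeal R) (MatlisModule R) := by
  intro e
  by_contra! hcon
  let N := Submodule.span R {e}
  have hmem : ∀ n, hullOne R ∈ (maximalIdeal R) ^ n • N := fun n => by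
    refine hullOne_mem fun h => ?_
    obtain ⟨r, hr, hre⟩ := hcon n
    have : r • e ∈ (maximalIdeal R) ^ n • N :=
      Submodule.smul_mem_smul hr (Submodule.mem_span_singleton_self e)
    rw [h, Submodule.mem_bot] at this
    exact hre this
  have h1 : hullOne R ∈ N := by simpa using hmem 0
  have h2 : (⟨hullOne R, h1⟩ : N) ∈ (⨅ n : ℕ, maximalIdeal R ^ n • ⊤ : Submodule R N) := by
    rw [Submodule.mem_iInf]
    intro n
    have h3 : ((maximalIdeal R) ^ n • (⊤ : Submodule R N)).map N.subtype =
        (maximalIdeal R) ^ n • N := by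
      rw [Submodule.map_smul'', Submodule.map_top, Submodule.range_subtype]
    have h4 := hmem n
    rw [← h3] at h4
    obtain ⟨y, hy, hy'⟩ := h4
    rwa [show y = ⟨hullOne R, h1⟩ from Subtype.ext hy'] at hy
  rw [Ideal.iInf_pow_smul_eq_bot_of_isLocalRing _ (Ideal.IsPrime.ne_top inferInstance),
    Submodule.mem_bot] at h2
  exact hullOne_ne_zero R (congrArg Subtype.val h2)

instance isArtinian_matlisModule : IsArtinian R (MatlisModule R) := by
  refine isArtinian_of_isPowerTorsion (maximalIdeal R) isPowerTorsion_matlisModule ?_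
  have hkill : ∀ r ∈ maximalIdeal R,
      ∀ x : Submodule.torsionBySet R (MatlisModule R) (maximalIdeal R : Set R), r • x = 0 :=
    fun r hr x => Subtype.ext ((Submodule.mem_torsionBySet_iff _ _).mp x.2 ⟨r, hr⟩)
  rw [← finite_iff_isArtinian_of_smul_eq_zero hkill]
  -- The socle of E is the line through `hullOne R`: a nonzero socle element has `hullOne R` as a
  -- multiple, and the multiplier must be a unit.
  have hle : Submodule.torsionBySet R (MatlisModule R) (maximalIdeal R : Set R) ≤
      Submodule.span R {hullOne R} := by
    intro y hy
    by_cases h0 : y = 0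
    · rw [h0]; exact zero_mem _
    have h1 : hullOne R ∈ Submodule.span R {y} := hullOne_mem (by simpa using h0)
    obtain ⟨r, hr⟩ := Submodule.mem_span_singleton.mp h1
    have hu : IsUnit r := by
      by_contra hu
      have : r • y = 0 := (Submodule.mem_torsionBySet_iff _ _).mp hy ⟨r, hu⟩
      exact hullOne_ne_zero R (hr.symm.trans this)
    obtain ⟨r, rfl⟩ := hu
    refine Submodule.mem_span_singleton.mpr ⟨(↑r⁻¹ : R), ?_⟩
    rw [← hr, smul_smul, Units.inv_mul, one_smul]
  exact Module.Finite.of_injective (Submodule.inclusion hle) (Submodule.inclusion_injective hle)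

omit [IsNoetherianRing R] in
-- Take a map to a power of E with minimal kernel. A nonzero element of that kernel is detected by
-- some functional, and adding this functional as a coordinate would shrink the kernel.
theorem exists_injective_of_isArtinian (A : Type u) [AddCommGroup A] [Module R A]
    [IsArtinian R A] :
    ∃ (n : ℕ) (f : A →ₗ[R] (Fin n → MatlisModule R)), Function.Injective f := by
  obtain ⟨_, ⟨n, f, rfl⟩, hmin⟩ := IsArtinian.set_has_minimal
    {K : Submodule R A | ∃ (n : ℕ) (f : A →ₗ[R] (Fin n → MatlisModule R)), LinearMap.ker f = K}
    ⟨_, 0, 0, rfl⟩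
  refine ⟨n, f, ?_⟩
  rw [← LinearMap.ker_eq_bot, Submodule.eq_bot_iff]
  intro x hx
  refine eq_zero_of_forall_dual (R := R) fun ψ => ?_
  by_contra hψ
  let g : A →ₗ[R] (Fin (n + 1) → MatlisModule R) :=
    (Fin.consLinearEquiv R fun _ => MatlisModule R).toLinearMap ∘ₗ ψ.prod f
  have hg : ∀ y, g y = 0 → ψ y = 0 ∧ f y = 0 := fun y hy => by
    have h1 : ψ.prod f y = 0 := by
      rw [← LinearEquiv.map_eq_zero_iff (Fin.consLinearEquiv R fun _ => MatlisModule R)]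
      exact hy
    exact ⟨congrArg Prod.fst h1, congrArg Prod.snd h1⟩
  refine hmin (LinearMap.ker g) ⟨n + 1, g, rfl⟩ (lt_of_le_of_ne (fun y hy => (hg y hy).2) ?_)
  intro h
  rw [← h] at hx
  exact hψ (hg x hx).1

theorem isPowerTorsion_of_isArtinian (A : Type u) [AddCommGroup A] [Module R A]
    [IsArtinian R A] : IsPowerTorsion (maximalIdeal R) A := by
  obtain ⟨n, f, hf⟩ := exists_injective_of_isArtinian (R := R) A
  exact (isPowerTorsion_matlisModule.fin n).of_injective f hf

instance isArtinian_dual_of_finite (M : Type u) [AddCommGroup M] [Module R M]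
    [Module.Finite R M] : IsArtinian R (MatlisDual R M) := by
  obtain ⟨n, f, hf⟩ := Module.Finite.exists_fin' R M
  refine isArtinian_of_injective (P := Fin n → MatlisModule R)
    (LinearMap.pi fun i => LinearMap.applyₗ (f (Pi.single i 1))) fun φ ψ h => ?_
  refine LinearMap.ext fun x => ?_
  obtain ⟨c, rfl⟩ := hf x
  rw [← LinearMap.comp_apply, ← LinearMap.comp_apply]
  refine LinearMap.congr_fun (LinearMap.pi_ext' fun i => LinearMap.ext_ring ?_) c
  exact congrFun h i

end Local

end MatlisExt

namespace MatlisExt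

open IsLocalRing

/-! ### Reflexive modules are mini-max with reflexive R/Ann -/

section Minimax

variable {R : Type u} [CommRing R] [IsNoetherianRing R] [IsLocalRing R]
variable {M : Type u} [AddCommGroup M] [Module R M]

theorem IsMatlisReflexive.isArtinian_of_isPowerTorsion (hM : IsMatlisReflexive R M)
    (h : IsPowerTorsion (maximalIdeal R) M) : IsArtinian R M := by
  refine MatlisExt.isArtinian_of_isPowerTorsion (maximalIdeal R) h ?_
  have hkill : ∀ r ∈ maximalIdeal R,
      ∀ x : Submodule.torsionBySet R M (maximalIdeal R : Set R), r • x = 0 :=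
    fun r hr x => Subtype.ext ((Submodule.mem_torsionBySet_iff _ _).mp x.2 ⟨r, hr⟩)
  rw [← finite_iff_isArtinian_of_smul_eq_zero hkill, ← isMatlisReflexive_iff_finite hkill]
  exact hM.of_injective (Submodule.subtype _) (Submodule.injective_subtype _)

/-- Artin–Rees for N ⊆ P: a high power times P meets N inside 𝔪^(1+t) N, which lies in 𝔪 Q. -/
theorem exists_pow_smul_inf_le {N P Q : Submodule R M} (hP : P.FG) (hNP : N ≤ P) {t : ℕ}
    (hQ : maximalIdeal R ^ t • N ≤ Q) :
    ∃ n : ℕ, maximalIdeal R ^ (n + 1) • P ⊓ N ≤ maximalIdeal R • Q := by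
  have : Module.Finite R P := Module.Finite.iff_fg.mpr hP
  obtain ⟨k, hk⟩ := Ideal.exists_pow_inf_eq_pow_smul (maximalIdeal R) (N.comap P.subtype)
  refine ⟨k + t, ?_⟩
  have h1 := congrArg (Submodule.map P.subtype) (hk (k + t + 1) (by omega))
  rw [Submodule.map_inf _ (Submodule.injective_subtype _), Submodule.map_smul'',
    Submodule.map_top, Submodule.range_subtype, Submodule.map_comap_subtype,
    inf_eq_right.mpr hNP, Submodule.map_smul'',
    show k + t + 1 - k = 1 + t by omega, pow_add _ 1 t, pow_one, mul_smul] at h1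
  rw [h1]
  refine Submodule.smul_mono le_rfl (le_trans (Submodule.smul_mono le_rfl ?_) hQ)
  refine (Submodule.map_mono inf_le_right).trans ?_
  rw [Submodule.map_comap_subtype]
  exact inf_le_right

/-- Take N' = N + Rx and V' = V + 𝔪^n x with n from Artin–Rees, so that 𝔪V' meets N only in 𝔪V. If
V' were inside N + 𝔪V', Nakayama would give 𝔪^n x ⊆ N. -/
theorem exists_enlarge {N V : Submodule R M} (hN : N.FG) (hVN : V ≤ N) {t : ℕ}
    (ht : maximalIdeal R ^ t • N ≤ V) {x : M}
    (hx : ∀ n : ℕ, ¬ maximalIdeal R ^ n • Submodule.span R {x} ≤ N) :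
    ∃ N' V' : Submodule R M, N'.FG ∧ V' ≤ N' ∧ (∃ t' : ℕ, maximalIdeal R ^ t' • N' ≤ V') ∧
      N ≤ N' ∧ V ≤ V' ∧ maximalIdeal R • V' ⊓ N ≤ maximalIdeal R • V ∧
      ¬ V' ≤ N ⊔ maximalIdeal R • V' := by
  set 𝔪 := maximalIdeal R
  have hN' : (N ⊔ Submodule.span R {x}).FG := hN.sup (Submodule.fg_span_singleton x)
  obtain ⟨n, hn⟩ := exists_pow_smul_inf_le hN' le_sup_left ht
  have hmV : 𝔪 • (V ⊔ 𝔪 ^ n • Submodule.span R {x}) =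
      𝔪 • V ⊔ 𝔪 ^ (n + 1) • Submodule.span R {x} := by
    rw [Submodule.smul_sup, ← mul_smul, ← pow_succ']
  refine ⟨N ⊔ Submodule.span R {x}, V ⊔ 𝔪 ^ n • Submodule.span R {x}, hN',
    sup_le_sup hVN Submodule.smul_le_right, ⟨max t n, ?_⟩, le_sup_left, le_sup_left, ?_, ?_⟩
  · rw [Submodule.smul_sup]
    exact sup_le_sup ((Submodule.smul_mono_left (Ideal.pow_le_pow_right (le_max_left _ _))).trans
      ht) (Submodule.smul_mono_left (Ideal.pow_le_pow_right (le_max_right _ _)))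
  · rw [hmV]
    rintro y ⟨hy, hyN⟩
    obtain ⟨v, hv, w, hw, rfl⟩ := Submodule.mem_sup.mp hy
    have hvN : v ∈ N := hVN (Submodule.smul_le_right hv)
    have hwN : w ∈ N := (Submodule.add_mem_iff_right N hvN).mp hyN
    exact add_mem hv (hn ⟨Submodule.smul_mono le_rfl le_sup_right hw, hwN⟩)
  · intro hle
    refine hx n (Submodule.le_of_le_smul_of_le_jacobson_bot (I := 𝔪)
      (Submodule.FG.smul (IsNoetherian.noetherian _) (Submodule.fg_span_singleton x))
      (maximalIdeal_le_jacobson _) ?_)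
    refine (le_sup_right.trans hle).trans ?_
    rw [hmV, ← mul_smul, ← pow_succ']
    exact sup_le le_sup_left (sup_le_sup
      ((Submodule.smul_le_right).trans hVN) le_rfl)

/-- Otherwise `exists_enlarge` can be iterated forever. The union W of the V_n then has W/𝔪W of
infinite dimension, although it is a submodule of the quotient M/𝔪W and so reflexive. -/
theorem IsMatlisReflexive.exists_fg_isPowerTorsion (hM : IsMatlisReflexive R M) :
    ∃ N : Submodule R M, N.FG ∧ IsPowerTorsion (maximalIdeal R) (M ⧸ N) := by
  by_contra! hcon
  set 𝔪 := maximalIdeal R with h𝔪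
  have hx : ∀ N : Submodule R M, N.FG → ∃ x : M, ∀ n : ℕ,
      ¬ 𝔪 ^ n • Submodule.span R {x} ≤ N := by
    intro N hN
    by_contra! h
    refine hcon N hN fun q => ?_
    obtain ⟨x, rfl⟩ := N.mkQ_surjective q
    obtain ⟨n, hn⟩ := h x
    refine ⟨n, fun r hr => ?_⟩
    rw [← map_smul, Submodule.mkQ_apply, Submodule.Quotient.mk_eq_zero]
    exact hn (Submodule.smul_mem_smul hr (Submodule.mem_span_singleton_self x))
  let St := {p : Submodule R M × Submodule R M //
    p.1.FG ∧ p.2 ≤ p.1 ∧ ∃ t : ℕ, 𝔪 ^ t • p.1 ≤ p.2}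
  have hstep : ∀ p : St, ∃ q : St, p.1.1 ≤ q.1.1 ∧ p.1.2 ≤ q.1.2 ∧
      𝔪 • q.1.2 ⊓ p.1.1 ≤ 𝔪 • p.1.2 ∧ ¬ q.1.2 ≤ p.1.1 ⊔ 𝔪 • q.1.2 := by
    rintro ⟨⟨N, V⟩, hN, hVN, t, ht⟩
    obtain ⟨x, hx⟩ := hx N hN
    obtain ⟨N', V', h1, h2, h3, h4, h5, h6, h7⟩ := exists_enlarge hN hVN ht hx
    exact ⟨⟨(N', V'), h1, h2, h3⟩, h4, h5, h6, h7⟩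
  choose step hs1 hs2 hs3 hs4 using hstep
  let s : ℕ → St := fun n => Nat.rec ⟨(⊥, ⊥), Submodule.fg_bot, le_rfl, 0, by simp⟩
    (fun _ p => step p) n
  let N : ℕ → Submodule R M := fun n => (s n).1.1
  let V : ℕ → Submodule R M := fun n => (s n).1.2
  have hNmono : Monotone N := monotone_nat_of_le_succ fun n => hs1 (s n)
  have hVmono : Monotone V := monotone_nat_of_le_succ fun n => hs2 (s n)
  have hVN : ∀ n, V n ≤ N n := fun n => (s n).2.2.1
  have hcap : ∀ k j, 𝔪 • V (k + j) ⊓ N k ≤ 𝔪 • V k := by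
    intro k j
    induction j with
    | zero => exact inf_le_left
    | succ j ih =>
      refine le_trans (le_inf ?_ inf_le_right) ih
      exact (inf_le_inf_left _ (hNmono (Nat.le_add_right k j))).trans (hs3 (s (k + j)))
  let W : Submodule R M := ⨆ n, V n
  have hmW : ∀ y, y ∈ 𝔪 • W → ∃ n, y ∈ 𝔪 • V n := by
    intro y hy
    rw [Submodule.smul_iSup] at hy
    exact (Submodule.mem_iSup_of_directed _ (Monotone.directed_le fun a b hab =>
      Submodule.smul_mono le_rfl (hVmono hab))).mp hy
  have hcapW : ∀ k, 𝔪 • W ⊓ N k ≤ 𝔪 • V k := by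
    rintro k y ⟨hy, hyN⟩
    obtain ⟨n, hn⟩ := hmW y hy
    exact hcap k n ⟨Submodule.smul_mono le_rfl (hVmono (Nat.le_add_left n k)) hn, hyN⟩
  let Q := W.map (𝔪 • W).mkQ
  have hQ : ∀ r ∈ 𝔪, ∀ q : Q, r • q = 0 := by
    rintro r hr ⟨_, y, hy, rfl⟩
    refine Subtype.ext ?_
    change r • (𝔪 • W).mkQ y = 0
    rw [← map_smul, Submodule.mkQ_apply, Submodule.Quotient.mk_eq_zero]
    exact Submodule.smul_mem_smul hr hy
  have hfin : Module.Finite R Q := (isMatlisReflexive_iff_finite hQ).mp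
    ((hM.of_surjective (𝔪 • W).mkQ (Submodule.mkQ_surjective _)).of_injective Q.subtype
      (Submodule.injective_subtype _))
  have hnoeth : IsNoetherian R Q := isNoetherian_of_isNoetherianRing_of_finite R Q
  obtain ⟨k, hk⟩ := monotone_stabilizes_iff_noetherian.mpr hnoeth
    ⟨fun n => ((V n).map (𝔪 • W).mkQ).comap Q.subtype, fun a b hab =>
      Submodule.comap_mono (Submodule.map_mono (hVmono hab))⟩
  -- Once the images of V_k and V_(k+1) in W/𝔪W agree, each v in V_(k+1) differs from some a in V_k
  -- by an element of 𝔪W ∩ N_(k+1) ⊆ 𝔪V_(k+1), contradicting the last property of the step.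
  refine hs4 (s k) fun v hv => ?_
  change v ∈ N k ⊔ 𝔪 • V (k + 1)
  have hv' : v ∈ V (k + 1) := hv
  have h1 : (⟨(𝔪 • W).mkQ v, v, le_iSup V (k + 1) hv', rfl⟩ : Q) ∈
      ((V k).map (𝔪 • W).mkQ).comap Q.subtype := by
    have h2 : ((V k).map (𝔪 • W).mkQ).comap Q.subtype =
      ((V (k + 1)).map (𝔪 • W).mkQ).comap Q.subtype := hk (k + 1) (Nat.le_succ k)
    rw [h2]
    exact ⟨v, hv', rfl⟩
  obtain ⟨a, ha, hav⟩ := h1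
  have h3 : v - a ∈ 𝔪 • W := by
    rw [← Submodule.Quotient.mk_eq_zero, Submodule.Quotient.mk_sub, sub_eq_zero]
    exact hav.symm
  have h4 : v - a ∈ 𝔪 • V (k + 1) := hcapW (k + 1)
    ⟨h3, sub_mem (hVN (k + 1) hv') (hVN (k + 1) (hVmono (Nat.le_succ k) ha))⟩
  have h5 := Submodule.add_mem_sup (hVN k ha) h4
  rwa [add_sub_cancel] at h5

theorem IsMatlisReflexive.isMinimax (hM : IsMatlisReflexive R M) : IsMinimax R M := by
  obtain ⟨N, hN, htor⟩ := hM.exists_fg_isPowerTorsion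
  have : Module.Finite R N := Module.Finite.iff_fg.mpr hN
  exact ⟨N, isNoetherian_of_isNoetherianRing_of_finite R N,
    (hM.of_surjective N.mkQ N.mkQ_surjective).isArtinian_of_isPowerTorsion htor⟩

omit [IsNoetherianRing R] in
-- Every functional on the dual is evaluation at a point of M, so a submodule W of the dual is
-- recovered from its annihilator in M; ascending chains in the dual become descending chains in M.
theorem IsMatlisReflexive.isNoetherian_dual [IsArtinian R M] (hM : IsMatlisReflexive R M) :
    IsNoetherian R (MatlisDual R M) := by
  let perp : Submodule R (MatlisDual R M) → Submodule R M := fun W =>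
    { carrier := {x | ∀ ψ ∈ W, ψ x = 0}
      add_mem' := fun {a b} ha hb ψ hψ => by rw [map_add, ha ψ hψ, hb ψ hψ, add_zero]
      zero_mem' := fun ψ _ => map_zero ψ
      smul_mem' := fun r x hx ψ hψ => by rw [map_smul, hx ψ hψ, smul_zero] }
  have hle : ∀ W W', perp W ≤ perp W' → W' ≤ W := fun W W' h ψ hψ => by
    refine mem_of_forall_dual (R := R) W fun Φ hΦ => ?_
    obtain ⟨x, hx⟩ := isMatlisReflexive_iff.mp hM Φ
    have : x ∈ perp W := fun φ hφ => by rw [← hx, hΦ φ hφ]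
    rw [hx]
    exact h this ψ hψ
  have hanti : StrictAnti perp := fun W W' h =>
    lt_of_le_not_ge (fun x hx ψ hψ => hx ψ (h.le hψ)) fun h' => h.not_ge (hle _ _ h')
  rw [isNoetherian_iff']
  exact hanti.wellFoundedGT

omit [IsNoetherianRing R] in
-- Acting on generators embeds R/Ann M in M^n.
theorem IsMatlisReflexive.quotient_annihilator_of_finite [Module.Finite R M]
    (hM : IsMatlisReflexive R M) : IsMatlisReflexive R (R ⧸ Module.annihilator R M) := by
  obtain ⟨n, f, hf⟩ := Module.Finite.exists_fin' R M
  let g : R →ₗ[R] (Fin n → M) :=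
    LinearMap.pi fun i => LinearMap.toSpanSingleton R M (f (Pi.single i 1))
  have hg : LinearMap.ker g = Module.annihilator R M := by
    ext r
    rw [LinearMap.mem_ker, Module.mem_annihilator]
    constructor
    · intro h x
      obtain ⟨c, rfl⟩ := hf x
      have h1 : r • f = 0 := LinearMap.pi_ext' fun i => LinearMap.ext_ring (congrFun h i)
      exact LinearMap.congr_fun h1 c
    · exact fun h => funext fun i => h _
  rw [← hg]
  exact (hM.fin n).of_injective ((LinearMap.ker g).liftQ g le_rfl) (by
    rw [← LinearMap.ker_eq_bot, Submodule.ker_liftQ_eq_bot _ _ _ le_rfl])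

omit [IsNoetherianRing R] in
theorem IsMatlisReflexive.quotient_of_le {I J : Ideal R} (h : I ≤ J)
    (hI : IsMatlisReflexive R (R ⧸ I)) : IsMatlisReflexive R (R ⧸ J) :=
  hI.of_surjective (Submodule.mapQ I J LinearMap.id h) fun y => by
    obtain ⟨x, rfl⟩ := Submodule.mkQ_surjective J y
    exact ⟨I.mkQ x, rfl⟩

omit [IsNoetherianRing R] in
-- The dual of M is finite and reflexive, and whatever kills it kills M.
theorem IsMatlisReflexive.quotient_annihilator_of_isArtinian [IsArtinian R M]
    (hM : IsMatlisReflexive R M) : IsMatlisReflexive R (R ⧸ Module.annihilator R M) := by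
  have := hM.isNoetherian_dual
  refine hM.dual.quotient_annihilator_of_finite.quotient_of_le fun r hr => ?_
  rw [Module.mem_annihilator] at hr ⊢
  refine fun x => eq_zero_of_forall_dual (R := R) fun ψ => ?_
  rw [map_smul]
  exact LinearMap.congr_fun (hr ψ) x

/-- R/IJ is an extension of R/I by I/IJ, and I/IJ is a quotient of (R/J)^n. -/
theorem IsMatlisReflexive.quotient_mul {I J : Ideal R} (hI : IsMatlisReflexive R (R ⧸ I))
    (hJ : IsMatlisReflexive R (R ⧸ J)) : IsMatlisReflexive R (R ⧸ (I * J)) := by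
  have : Module.Finite R I := Module.Finite.iff_fg.mpr (IsNoetherian.noetherian I)
  obtain ⟨n, f, hf⟩ := Module.Finite.exists_fin' R I
  let h : Fin n → R ⧸ J →ₗ[R] R ⧸ (I * J) := fun i =>
    Submodule.mapQ J (I * J) (LinearMap.mulLeft R (f (Pi.single i 1) : R)) fun r hr =>
      Ideal.mul_mem_mul (f (Pi.single i 1)).2 hr
  let g : (Fin n → R ⧸ J) →ₗ[R] R ⧸ (I * J) := LinearMap.lsum R (fun _ => R ⧸ J) R h
  refine .of_exact g (Submodule.mapQ (I * J) I LinearMap.id fun r hr => Ideal.mul_le_left hr)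
    (fun y => ?_) (hJ.fin n) hI
  have hgf : ∀ c : Fin n → R, g (fun i => Submodule.Quotient.mk (c i)) =
      Submodule.Quotient.mk (f c : R) := by
    intro c
    let p : (Fin n → R) →ₗ[R] (Fin n → R ⧸ J) := LinearMap.pi fun i =>
      (Submodule.mkQ J) ∘ₗ LinearMap.proj i
    have : g ∘ₗ p = (I * J).mkQ ∘ₗ (Submodule.subtype I) ∘ₗ f := by
      refine LinearMap.pi_ext' fun i => LinearMap.ext_ring ?_
      have hp : p (Pi.single i 1) = Pi.single i (Submodule.Quotient.mk 1) := by
        ext j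
        by_cases hij : j = i
        · subst hij; simp [p]
        · simp [p, hij]
      simp only [LinearMap.comp_apply, LinearMap.single_apply, hp]
      rw [LinearMap.lsum_piSingle]
      change Submodule.Quotient.mk ((f (Pi.single i 1) : R) * 1) = _
      rw [mul_one]
      rfl
    exact LinearMap.congr_fun this c
  obtain ⟨r, rfl⟩ := Submodule.mkQ_surjective (I * J) y
  constructor
  · intro hr
    have hrI : r ∈ I := (Submodule.Quotient.mk_eq_zero I).mp hr
    obtain ⟨c, hc⟩ := hf ⟨r, hrI⟩
    exact ⟨_, (hgf c).trans (by rw [hc]; rfl)⟩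
  · rintro ⟨d, hd⟩
    choose c hc using fun i => Submodule.mkQ_surjective J (d i)
    have hd' : d = fun i => Submodule.Quotient.mk (c i) := funext fun i => (hc i).symm
    rw [← hd, hd', hgf]
    exact (Submodule.Quotient.mk_eq_zero I).mpr (f c).2

theorem IsMatlisReflexive.quotient_annihilator (hM : IsMatlisReflexive R M) :
    IsMatlisReflexive R (R ⧸ Module.annihilator R M) := by
  obtain ⟨N, _, _⟩ := hM.isMinimax
  refine ((hM.of_injective N.subtype N.injective_subtype).quotient_annihilator_of_finite.quotient_mul
    (hM.of_surjective N.mkQ N.mkQ_surjective).quotient_annihilator_of_isArtinian).quotient_of_le ?_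
  refine Ideal.mul_le.mpr fun r hr s hs => ?_
  rw [Module.mem_annihilator] at hr hs ⊢
  intro x
  have h1 : s • x ∈ N := by
    rw [← Submodule.Quotient.mk_eq_zero]
    exact hs (N.mkQ x)
  rw [mul_smul]
  exact congrArg Subtype.val (hr ⟨s • x, h1⟩)

omit [IsNoetherianRing R] in
theorem IsMatlisReflexive.of_finite {I : Ideal R} (hI : IsMatlisReflexive R (R ⧸ I))
    [Module.Finite R M] (hM : ∀ r ∈ I, ∀ x : M, r • x = 0) : IsMatlisReflexive R M := by
  obtain ⟨n, f, hf⟩ := Module.Finite.exists_fin' R M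
  let g : (Fin n → R ⧸ I) →ₗ[R] M := LinearMap.lsum R (fun _ => R ⧸ I) R fun i =>
    Submodule.liftQ I (LinearMap.toSpanSingleton R M (f (Pi.single i 1))) fun r hr => hM r hr _
  refine (hI.fin n).of_surjective g fun x => ?_
  obtain ⟨c, rfl⟩ := hf x
  let p : (Fin n → R) →ₗ[R] (Fin n → R ⧸ I) := LinearMap.pi fun i =>
    (Submodule.mkQ I) ∘ₗ LinearMap.proj i
  refine ⟨p c, ?_⟩
  have : g ∘ₗ p = f := by
    refine LinearMap.pi_ext' fun i => LinearMap.ext_ring ?_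
    have hp : p (Pi.single i 1) = Pi.single i (Submodule.Quotient.mk 1) := by
      ext j
      by_cases hij : j = i
      · subst hij; simp [p]
      · simp [p, hij]
    simp only [LinearMap.comp_apply, LinearMap.single_apply, hp]
    rw [LinearMap.lsum_piSingle]
    change (1 : R) • f (Pi.single i 1) = _
    rw [one_smul]
  exact LinearMap.congr_fun this c

omit [IsNoetherianRing R] in
-- M embeds in E^n; being killed by I, it lands in Hom(R/I, E)^n, a power of the dual of a reflexive
-- module.
theorem IsMatlisReflexive.of_isArtinian {I : Ideal R} (hI : IsMatlisReflexive R (R ⧸ I))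
    [IsArtinian R M] (hM : ∀ r ∈ I, ∀ x : M, r • x = 0) : IsMatlisReflexive R M := by
  obtain ⟨n, f, hf⟩ := exists_injective_of_isArtinian (R := R) M
  let g : M →ₗ[R] (Fin n → MatlisDual R (R ⧸ I)) := LinearMap.pi fun i =>
    { toFun := fun x => Submodule.liftQ I (LinearMap.toSpanSingleton R _ (f x i)) fun r hr => by
        rw [LinearMap.mem_ker, LinearMap.toSpanSingleton_apply, ← Pi.smul_apply, ← map_smul,
          hM r hr, map_zero, Pi.zero_apply]
      map_add' := fun x y => by
        refine Submodule.linearMap_qext _ (LinearMap.ext fun r => ?_)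
        change r • f (x + y) i = r • f x i + r • f y i
        rw [map_add, Pi.add_apply, smul_add]
      map_smul' := fun c x => by
        refine Submodule.linearMap_qext _ (LinearMap.ext fun r => ?_)
        change r • f (c • x) i = c • r • f x i
        rw [map_smul, Pi.smul_apply, smul_comm] }
  refine (hI.dual.fin n).of_injective g fun x y h => hf (funext fun i => ?_)
  have h1 := LinearMap.congr_fun (congrFun h i) (Submodule.Quotient.mk 1)
  have h2 : ∀ z : M, g z i (Submodule.Quotient.mk 1) = f z i := fun z => one_smul R _
  rwa [h2, h2] at h1

end Minimax

end MatlisExt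

namespace MatlisExt

open IsLocalRing

/-! ### The canonical structure over the completion -/

section Completion

variable {R : Type u} [CommRing R] [IsNoetherianRing R] [IsLocalRing R]

/-- The element dies in the completion of R/I. By exactness of completion on finite modules it comes
from the completion of I, which generators of I span over R̂. -/
theorem mk_mem_map_of_forall_mem_sup (I : Ideal R)
    (a : AdicCompletion.AdicCauchySequence (maximalIdeal R) R)
    (ha : ∀ n, a n ∈ I ⊔ maximalIdeal R ^ n) :
    AdicCompletion.mk (maximalIdeal R) R a ∈ I.map (algebraMap R (Completion R)) := by
  have h0 : AdicCompletion.map (maximalIdeal R) I.mkQ (AdicCompletion.mk _ R a) = 0 := by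
    refine AdicCompletion.ext fun n => ?_
    rw [AdicCompletion.map_mk, AdicCompletion.val_zero_apply]
    change Submodule.Quotient.mk (I.mkQ (a n)) = _
    rw [Submodule.Quotient.mk_eq_zero]
    obtain ⟨i, hi, j, hj, hij⟩ := Submodule.mem_sup.mp (ha n)
    have : I.mkQ (a n) = j • I.mkQ 1 := by
      rw [← hij, map_add, ← map_smul, smul_eq_mul, mul_one, Submodule.mkQ_apply,
        (Submodule.Quotient.mk_eq_zero I).mpr hi, zero_add]
    rw [this]
    exact Submodule.smul_mem_smul hj trivial
  obtain ⟨y, hy⟩ := (AdicCompletion.map_exact (I := maximalIdeal R)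
    (f := I.subtype) (g := I.mkQ) I.injective_subtype
    (LinearMap.exact_subtype_mkQ I) I.mkQ_surjective _).mp h0
  have : Module.Finite R I := Module.Finite.iff_fg.mpr (IsNoetherian.noetherian I)
  obtain ⟨n, f, hf⟩ := Module.Finite.exists_fin' R I
  obtain ⟨z, rfl⟩ := AdicCompletion.map_surjective (maximalIdeal R) hf y
  obtain ⟨ζ, rfl⟩ := AdicCompletion.mk_surjective _ _ z
  have hsum : AdicCompletion.mk (maximalIdeal R) R a =
      ∑ i, algebraMap R (Completion R) (f (Pi.single i 1) : R) *
        AdicCompletion.map (maximalIdeal R) (LinearMap.proj i : (Fin n → R) →ₗ[R] R)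
          (AdicCompletion.mk (maximalIdeal R) (Fin n → R) ζ) := by
    rw [← hy]
    refine AdicCompletion.ext fun k => ?_
    rw [AdicCompletion.val_sum_apply]
    have hfz : ∀ c : Fin n → R, (f c : R) = ∑ i, (f (Pi.single i 1) : R) * c i := fun c => by
      conv_lhs => rw [pi_eq_sum_univ' c]
      rw [map_sum, AddSubmonoidClass.coe_finsetSum]
      refine Finset.sum_congr rfl fun i _ => ?_
      rw [map_smul, Submodule.coe_smul, smul_eq_mul, mul_comm]
    change Submodule.mkQ _ (f (ζ k) : R) = _
    rw [hfz, map_sum]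
    rfl
  rw [hsum]
  exact Ideal.sum_mem _ fun i _ => Ideal.mul_mem_right _ _
    (Ideal.mem_map_of_mem _ (f (Pi.single i 1)).2)

/-- R̂ acts on E because E is power torsion, so ψ ↦ x ψ(1) is a bidual element of R/I. Reflexivity
represents it by some s in R, and x - s is then in IR̂. -/
theorem IsMatlisReflexive.exists_sub_mem_map {I : Ideal R} (hI : IsMatlisReflexive R (R ⧸ I))
    (x : Completion R) :
    ∃ s : R, x - algebraMap R (Completion R) s ∈ I.map (algebraMap R (Completion R)) := by
  obtain ⟨a, rfl⟩ := AdicCompletion.mk_surjective _ _ x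
  choose N hN using isPowerTorsion_matlisModule (R := R)
  have hcauchy : ∀ {m n : ℕ}, m ≤ n → a n - a m ∈ maximalIdeal R ^ m := fun {m n} hmn => by
    have h := (Submodule.Quotient.eq _).mp (AdicCompletion.AdicCauchySequence.mk_eq_mk hmn a)
    simpa using h
  have hact : ∀ e : MatlisModule R, ∀ m, (∀ r ∈ maximalIdeal R ^ m, r • e = 0) →
      ∀ n, m ≤ n → a n • e = a m • e := fun e m hm n hn => by
    rw [← sub_eq_zero, ← sub_smul, hm _ (hcauchy hn)]
  have hact' : ∀ e : MatlisModule R, ∀ m, (∀ r ∈ maximalIdeal R ^ m, r • e = 0) →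
      a (N e) • e = a m • e := fun e m hm => by
    rw [← hact e (N e) (hN e) (max (N e) m) (le_max_left _ _),
      ← hact e m hm (max (N e) m) (le_max_right _ _)]
  -- The action of x on e is the eventual value of `a n • e`, already reached at any exponent whose
  -- power of the maximal ideal kills e.
  let Φ : MatlisDual R (MatlisDual R (R ⧸ I)) :=
    { toFun := fun ψ => a (N (ψ (I.mkQ 1))) • ψ (I.mkQ 1)
      map_add' := fun ψ φ => by
        let n := max (N (ψ (I.mkQ 1))) (N (φ (I.mkQ 1)))
        have h1 : ∀ r ∈ maximalIdeal R ^ n, r • ψ (I.mkQ 1) = 0 := fun r hr =>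
          hN _ r (Ideal.pow_le_pow_right (le_max_left _ _) hr)
        have h2 : ∀ r ∈ maximalIdeal R ^ n, r • φ (I.mkQ 1) = 0 := fun r hr =>
          hN _ r (Ideal.pow_le_pow_right (le_max_right _ _) hr)
        rw [hact' _ n h1, hact' _ n h2, hact' ((ψ + φ) (I.mkQ 1)) n (fun r hr => by
          rw [LinearMap.add_apply, smul_add, h1 r hr, h2 r hr, add_zero]),
          LinearMap.add_apply, smul_add]
      map_smul' := fun c ψ => by
        rw [hact' ((c • ψ) (I.mkQ 1)) (N (ψ (I.mkQ 1))) (fun r hr => by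
          rw [LinearMap.smul_apply, smul_comm, hN _ r hr, smul_zero]), LinearMap.smul_apply,
          smul_comm, RingHom.id_apply] }
  obtain ⟨s', hs⟩ := isMatlisReflexive_iff.mp hI Φ
  obtain ⟨s, rfl⟩ := I.mkQ_surjective s'
  refine ⟨s, ?_⟩
  let b : AdicCompletion.AdicCauchySequence (maximalIdeal R) R :=
    ⟨fun n => a n - s, fun {m n} hmn => SModEq.sub (a.2 hmn) rfl⟩
  have hb : AdicCompletion.mk (maximalIdeal R) R b =
      AdicCompletion.mk (maximalIdeal R) R a - algebraMap R (Completion R) s := rfl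
  rw [← hb]
  refine mk_mem_map_of_forall_mem_sup I b fun n => ?_
  change a n - s ∈ I ⊔ maximalIdeal R ^ n
  refine mem_of_forall_dual (R := R) _ fun ψ hψ => ?_
  let ψ' : MatlisDual R (R ⧸ I) := I.liftQ ψ fun r hr => hψ r (Ideal.mem_sup_left hr)
  have h1 : ∀ r ∈ maximalIdeal R ^ n, r • ψ 1 = 0 := fun r hr => by
    rw [← map_smul, smul_eq_mul, mul_one]
    exact hψ r (Ideal.mem_sup_right hr)
  have h2 : a (N (ψ 1)) • ψ 1 = ψ s := hs ψ'
  have h3 : ∀ r : R, ψ r = r • ψ 1 := fun r => by rw [← map_smul, smul_eq_mul, mul_one]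
  rw [map_sub, ← h2, hact' _ n h1, h3 (a n), sub_self]

/-- Reduction modulo each power puts s in I + 𝔪^n; Krull's intersection theorem in R/I finishes. -/
theorem mem_of_algebraMap_mem_map {I : Ideal R} {s : R}
    (hs : algebraMap R (Completion R) s ∈ I.map (algebraMap R (Completion R))) : s ∈ I := by
  have h1 : ∀ n, s ∈ I ⊔ maximalIdeal R ^ n := fun n => by
    have h2 := Ideal.mem_map_of_mem (AdicCompletion.evalₐ (maximalIdeal R) n).toRingHom hs
    rw [Ideal.map_map] at h2
    have h3 : (AdicCompletion.evalₐ (maximalIdeal R) n).toRingHom.comp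
        (algebraMap R (Completion R)) = Ideal.Quotient.mk (maximalIdeal R ^ n) :=
      (AdicCompletion.evalₐ (maximalIdeal R) n).comp_algebraMap
    have h4 : (AdicCompletion.evalₐ (maximalIdeal R) n).toRingHom
        (algebraMap R (Completion R) s) = Ideal.Quotient.mk (maximalIdeal R ^ n) s :=
      RingHom.congr_fun h3 s
    rw [h3, h4, ← Ideal.mem_comap, Ideal.comap_map_of_surjective _ Ideal.Quotient.mk_surjective,
      ← RingHom.ker_eq_comap_bot, Ideal.mk_ker] at h2
    exact h2
  have h2 : I.mkQ s ∈ (⨅ n : ℕ, maximalIdeal R ^ n • ⊤ : Submodule R (R ⧸ I)) := by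
    rw [Submodule.mem_iInf]
    intro n
    obtain ⟨i, hi, j, hj, hij⟩ := Submodule.mem_sup.mp (h1 n)
    have : I.mkQ s = j • I.mkQ 1 := by
      rw [← hij, map_add, ← map_smul, smul_eq_mul, mul_one, Submodule.mkQ_apply,
        (Submodule.Quotient.mk_eq_zero I).mpr hi, zero_add]
    rw [this]
    exact Submodule.smul_mem_smul hj trivial
  rw [Ideal.iInf_pow_smul_eq_bot_of_isLocalRing _ (Ideal.IsPrime.ne_top inferInstance),
    Submodule.mem_bot] at h2
  exact (Submodule.Quotient.mk_eq_zero I).mp h2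

variable {L : Type u} [AddCommGroup L] [Module R L]

/-- Any compatible R̂-structure kills J = IR̂, and R → R̂/J is onto, so it is the structure pulled
back from R̂/J. Reflexivity passes from R to R̂/J and from there to R̂. -/
theorem IsMatlisReflexive.isMatlisReflexiveOverCompletion (hL : IsMatlisReflexive R L) :
    IsMatlisReflexiveOverCompletion R L := by
  have hI := hL.quotient_annihilator
  set I := Module.annihilator R L with hIdef
  let J := I.map (algebraMap R (Completion R))
  have hsurj : Function.Surjective (algebraMap R (Completion R ⧸ J)) := fun q => by
    obtain ⟨x, rfl⟩ := Ideal.Quotient.mk_surjective q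
    obtain ⟨s, hs⟩ := hI.exists_sub_mem_map x
    exact ⟨s, (Ideal.Quotient.eq.mpr hs).symm⟩
  have hker : ∀ r : R, algebraMap R (Completion R ⧸ J) r = 0 → ∀ x : L, r • x = 0 := by
    intro r hr
    have h1 : algebraMap R (Completion R) r ∈ J := Ideal.Quotient.eq_zero_iff_mem.mp hr
    exact Module.mem_annihilator.mp (mem_of_algebraMap_mem_map h1)
  have hkill : ∀ [Module (Completion R) L] [IsScalarTower R (Completion R) L],
      ∀ r ∈ J, ∀ x : L, r • x = 0 := by
    intro _ _ r hr
    have : J ≤ Module.annihilator (Completion R) L := Ideal.map_le_iff_le_comap.mpr fun s hs => by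
      rw [Ideal.mem_comap, Module.mem_annihilator]
      intro x
      rw [algebraMap_smul]
      exact Module.mem_annihilator.mp hs x
    exact Module.mem_annihilator.mp (this hr)
  refine ⟨?_, ?_⟩
  · let := moduleOfSurjective hsurj L hker
    have := moduleOfSurjective_isScalarTower hsurj L hker
    refine ⟨Module.compHom L (Ideal.Quotient.mk J), ?_, ?_⟩
    · let : Module (Completion R) L := Module.compHom L (Ideal.Quotient.mk J)
      refine IsScalarTower.of_algebraMap_smul fun r x => ?_
      change algebraMap R (Completion R ⧸ J) r • x = r • x
      rw [algebraMap_smul]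
    · intro inst hinst
      refine Module.ext' _ _ fun x y => ?_
      obtain ⟨s, hs⟩ := hI.exists_sub_mem_map x
      have h1 := hkill _ hs y
      rw [sub_smul, sub_eq_zero, algebraMap_smul] at h1
      rw [h1]
      change s • y = Ideal.Quotient.mk J x • y
      rw [Ideal.Quotient.eq.mpr hs]
      change s • y = algebraMap R (Completion R ⧸ J) s • y
      rw [algebraMap_smul]
  · intro _ _
    -- For L = 0 the ring R̂/J is zero and hence not local.
    rcases subsingleton_or_nontrivial L with hsub | hnt
    · exact .of_subsingleton
    have hnt' : Nontrivial (Completion R ⧸ J) := by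
      rw [← not_subsingleton_iff_nontrivial]
      intro hsub
      obtain ⟨y, hy⟩ := exists_ne (0 : L)
      refine hy ?_
      rw [← one_smul R y]
      exact hker 1 (Subsingleton.elim _ _) y
    have hloc : IsLocalRing (Completion R ⧸ J) :=
      IsLocalRing.of_surjective' (Ideal.Quotient.mk J) Ideal.Quotient.mk_surjective
    have hS : Function.Surjective (algebraMap (Completion R) (Completion R ⧸ J)) :=
      Ideal.Quotient.mk_surjective
    have hT : ∀ r : Completion R, algebraMap (Completion R) (Completion R ⧸ J) r = 0 →
        ∀ x : L, r • x = 0 := fun r hr => hkill r (Ideal.Quotient.eq_zero_iff_mem.mp hr)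
    let := moduleOfSurjective hS L hT
    have := moduleOfSurjective_isScalarTower hS L hT
    have : IsScalarTower R (Completion R ⧸ J) L := IsScalarTower.of_algebraMap_smul fun r x => by
      change algebraMap (Completion R) (Completion R ⧸ J) (algebraMap R (Completion R) r) • x = _
      rw [algebraMap_smul, algebraMap_smul]
    rw [isMatlisReflexive_iff_of_surjective hS, ← isMatlisReflexive_iff_of_surjective hsurj]
    exact hL

end Completion

end MatlisExt

namespace MatlisExt

open IsLocalRing CategoryTheory

/-! ### Linear long exact sequences of Ext -/

section Ext

variable {R : Type u} [CommRing R]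

/-- `Ext` of unbundled modules. -/
abbrev ExtMod (R : Type u) [CommRing R] (X Y : Type u) [AddCommGroup X] [Module R X]
    [AddCommGroup Y] [Module R Y] (n : ℕ) : Type u :=
  Abelian.Ext (ModuleCat.of R X) (ModuleCat.of R Y) n

variable (X Y : Type u) [AddCommGroup X] [Module R X] [AddCommGroup Y] [Module R Y]
variable {A B C : Type u} [AddCommGroup A] [Module R A] [AddCommGroup B] [Module R B]
  [AddCommGroup C] [Module R C]

/-- Functoriality of `Ext` in the second variable. -/
noncomputable def extMapRight (f : A →ₗ[R] B) (n : ℕ) : ExtMod R X A n →ₗ[R] ExtMod R X B n :=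
  (Abelian.Ext.mk₀ (ModuleCat.ofHom f)).postcompOfLinear R (ModuleCat.of R X) (add_zero n)

/-- Functoriality of `Ext` in the first variable. -/
noncomputable def extMapLeft (f : A →ₗ[R] B) (n : ℕ) : ExtMod R B Y n →ₗ[R] ExtMod R A Y n :=
  (Abelian.Ext.mk₀ (ModuleCat.ofHom f)).precompOfLinear R (ModuleCat.of R Y) (zero_add n)

/-- `Ext⁰` is `Hom`. -/
noncomputable def extZeroEquiv : ExtMod R X Y 0 ≃ₗ[R] (X →ₗ[R] Y) :=
  Abelian.Ext.linearEquiv₀.trans ModuleCat.homLinearEquiv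

theorem shortExact_mk {f : A →ₗ[R] B} {g : B →ₗ[R] C} (hf : Function.Injective f)
    (hfg : Function.Exact f g) (hg : Function.Surjective g) :
    (ShortComplex.mk (ModuleCat.ofHom f) (ModuleCat.ofHom g)
      (by rw [← ModuleCat.ofHom_comp, hfg.linearMap_comp_eq_zero]; rfl)).ShortExact :=
  ModuleCat.shortComplex_shortExact _ hfg hf hg

variable {f : A →ₗ[R] B} {g : B →ₗ[R] C} (hf : Function.Injective f)
    (hfg : Function.Exact f g) (hg : Function.Surjective g)

include hf hfg hg

theorem extMapRight_exact (n : ℕ) :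
    Function.Exact (extMapRight X f n) (extMapRight X g n) := by
  intro x
  constructor
  · exact fun hx => Abelian.Ext.covariant_sequence_exact₂ _ (shortExact_mk hf hfg hg) x hx
  · rintro ⟨y, rfl⟩
    change (y.comp (Abelian.Ext.mk₀ _) (add_zero n)).comp (Abelian.Ext.mk₀ _) (add_zero n) = 0
    rw [Abelian.Ext.comp_assoc_of_third_deg_zero, Abelian.Ext.mk₀_comp_mk₀,
      ← ModuleCat.ofHom_comp, hfg.linearMap_comp_eq_zero]
    change y.comp (Abelian.Ext.mk₀ 0) (add_zero n) = 0
    rw [Abelian.Ext.mk₀_zero, Abelian.Ext.comp_zero]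

theorem extMapLeft_exact (n : ℕ) :
    Function.Exact (extMapLeft Y g n) (extMapLeft Y f n) := by
  intro x
  constructor
  · exact fun hx => Abelian.Ext.contravariant_sequence_exact₂ (shortExact_mk hf hfg hg) _ x hx
  · rintro ⟨y, rfl⟩
    change (Abelian.Ext.mk₀ _).comp ((Abelian.Ext.mk₀ _).comp y (zero_add n)) (zero_add n) = 0
    rw [Abelian.Ext.mk₀_comp_mk₀_assoc, ← ModuleCat.ofHom_comp, hfg.linearMap_comp_eq_zero]
    change (Abelian.Ext.mk₀ 0).comp y (zero_add n) = 0
    rw [Abelian.Ext.mk₀_zero, Abelian.Ext.zero_comp]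

theorem exists_ext_connecting_right (n : ℕ) :
    ∃ δ : ExtMod R X C n →ₗ[R] ExtMod R X A (n + 1),
      Function.Exact (extMapRight X g n) δ ∧ Function.Exact δ (extMapRight X f (n + 1)) := by
  let S := shortExact_mk hf hfg hg
  refine ⟨S.extClass.postcompOfLinear R (ModuleCat.of R X) rfl, fun x => ⟨?_, ?_⟩,
    fun x => ⟨?_, ?_⟩⟩
  · exact fun hx => Abelian.Ext.covariant_sequence_exact₃ _ S x rfl hx
  · rintro ⟨y, rfl⟩
    change (y.comp (Abelian.Ext.mk₀ _) (add_zero n)).comp S.extClass rfl = 0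
    rw [Abelian.Ext.comp_assoc y (Abelian.Ext.mk₀ _) S.extClass (by omega) (zero_add 1) (by omega)]
    exact (congrArg (fun z => y.comp z _) S.comp_extClass).trans (Abelian.Ext.comp_zero _ _ _ _ _)
  · exact fun hx => Abelian.Ext.covariant_sequence_exact₁ _ S x hx rfl
  · rintro ⟨y, rfl⟩
    change (y.comp S.extClass rfl).comp (Abelian.Ext.mk₀ _) (add_zero (n + 1)) = 0
    rw [Abelian.Ext.comp_assoc y S.extClass (Abelian.Ext.mk₀ _) (by omega) (add_zero 1) (by omega)]
    exact (congrArg (fun z => y.comp z _) S.extClass_comp).trans (Abelian.Ext.comp_zero _ _ _ _ _)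

theorem exists_ext_connecting_left (n : ℕ) :
    ∃ δ : ExtMod R A Y n →ₗ[R] ExtMod R C Y (n + 1),
      Function.Exact (extMapLeft Y f n) δ ∧ Function.Exact δ (extMapLeft Y g (n + 1)) := by
  let S := shortExact_mk hf hfg hg
  refine ⟨S.extClass.precompOfLinear R (ModuleCat.of R Y) (add_comm 1 n), fun x => ⟨?_, ?_⟩,
    fun x => ⟨?_, ?_⟩⟩
  · exact fun hx => Abelian.Ext.contravariant_sequence_exact₁ S _ x (add_comm 1 n) hx
  · rintro ⟨y, rfl⟩
    exact S.extClass_comp_assoc y (h := add_comm 1 n)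
  · exact fun hx => Abelian.Ext.contravariant_sequence_exact₃ S _ x hx (add_comm 1 n)
  · rintro ⟨y, rfl⟩
    exact S.comp_extClass_assoc y (add_comm 1 n)

omit hf hfg hg

theorem subsingleton_ext_of_projective [Module.Projective R X] (n : ℕ) :
    Subsingleton (ExtMod R X Y (n + 1)) := by
  have : Projective (ModuleCat.of R X) :=
    (IsProjective.iff_projective X).mp inferInstance
  exact Abelian.Ext.subsingleton_of_projective _ _ n

theorem subsingleton_ext_of_injective [Module.Injective R Y] (n : ℕ) :
    Subsingleton (ExtMod R X Y (n + 1)) := by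
  have : Injective (ModuleCat.of R Y) :=
    (Module.injective_iff_injective_object R Y).mp inferInstance
  exact Abelian.Ext.subsingleton_of_injective _ _ n

theorem ext_smul_eq_zero_of_right {r : R} (hr : ∀ y : Y, r • y = 0) (n : ℕ) (e : ExtMod R X Y n) :
    r • e = 0 := by
  rw [Abelian.Ext.smul_eq_comp_mk₀]
  have : r • 𝟙 (ModuleCat.of R Y) = 0 := by
    ext y
    exact hr y
  rw [this, Abelian.Ext.mk₀_zero, Abelian.Ext.comp_zero]

theorem ext_smul_eq_zero_of_left {r : R} (hr : ∀ x : X, r • x = 0) (n : ℕ) (e : ExtMod R X Y n) :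
    r • e = 0 := by
  have h : r • 𝟙 (ModuleCat.of R X) = 0 := by
    ext x
    exact hr x
  rw [← Abelian.Ext.mk₀_id_comp e, ← Abelian.Ext.smul_comp, ← Abelian.Ext.mk₀_smul, h,
    Abelian.Ext.mk₀_zero, Abelian.Ext.zero_comp]

theorem extMapRight_lsmul (r : R) (n : ℕ) (e : ExtMod R X Y n) :
    extMapRight X (LinearMap.lsmul R Y r) n e = r • e := by
  rw [Abelian.Ext.smul_eq_comp_mk₀]
  rfl

theorem extMapRight_zero_injective (hf : Function.Injective f) :
    Function.Injective (extMapRight X f 0) := by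
  have : Mono (ModuleCat.ofHom f) := (ModuleCat.mono_iff_injective _).mpr hf
  exact Abelian.Ext.postcomp_mk₀_injective_of_mono (ModuleCat.of R X) (ModuleCat.ofHom f)

/-- `Ext` respects isomorphisms in the second variable. -/
noncomputable def extCongrRight (e : A ≃ₗ[R] B) (n : ℕ) :
    ExtMod R X A n ≃ₗ[R] ExtMod R X B n :=
  LinearEquiv.ofLinearMap (extMapRight X e.toLinearMap n) (extMapRight X e.symm.toLinearMap n)
    (LinearMap.ext fun x => by
      change (x.comp (Abelian.Ext.mk₀ _) (add_zero n)).comp (Abelian.Ext.mk₀ _) (add_zero n) = x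
      rw [Abelian.Ext.comp_assoc_of_third_deg_zero, Abelian.Ext.mk₀_comp_mk₀,
        ← ModuleCat.ofHom_comp, LinearEquiv.comp_symm]
      exact Abelian.Ext.comp_mk₀_id x)
    (LinearMap.ext fun x => by
      change (x.comp (Abelian.Ext.mk₀ _) (add_zero n)).comp (Abelian.Ext.mk₀ _) (add_zero n) = x
      rw [Abelian.Ext.comp_assoc_of_third_deg_zero, Abelian.Ext.mk₀_comp_mk₀,
        ← ModuleCat.ofHom_comp, LinearEquiv.symm_comp]
      exact Abelian.Ext.comp_mk₀_id x)

end Ext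

/-! ### Ext from finite modules and into artinian modules -/

section Devissage

variable {R : Type u} [CommRing R] [IsLocalRing R]
variable {X Y : Type u} [AddCommGroup X] [Module R X] [AddCommGroup Y] [Module R Y]

theorem isMatlisReflexive_ext_of_right (N : Submodule R Y) (n : ℕ)
    (h₁ : IsMatlisReflexive R (ExtMod R X N n))
    (h₂ : IsMatlisReflexive R (ExtMod R X (Y ⧸ N) n)) :
    IsMatlisReflexive R (ExtMod R X Y n) :=
  .of_exact _ _ (extMapRight_exact X N.injective_subtype (LinearMap.exact_subtype_mkQ N)
    N.mkQ_surjective n) h₁ h₂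

theorem isMatlisReflexive_ext_of_left (N : Submodule R X) (n : ℕ)
    (h₁ : IsMatlisReflexive R (ExtMod R N Y n))
    (h₂ : IsMatlisReflexive R (ExtMod R (X ⧸ N) Y n)) :
    IsMatlisReflexive R (ExtMod R X Y n) :=
  .of_exact _ _ (extMapLeft_exact Y N.injective_subtype (LinearMap.exact_subtype_mkQ N)
    N.mkQ_surjective n) h₂ h₁

theorem IsMatlisReflexive.hom_of_finite [Module.Finite R X] (hY : IsMatlisReflexive R Y) :
    IsMatlisReflexive R (X →ₗ[R] Y) := by
  obtain ⟨n, f, hf⟩ := Module.Finite.exists_fin' R X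
  refine (hY.fin n).of_injective
    (LinearMap.pi fun i => LinearMap.applyₗ (f (Pi.single i 1))) fun φ ψ h => ?_
  refine LinearMap.ext fun x => ?_
  obtain ⟨c, rfl⟩ := hf x
  rw [← LinearMap.comp_apply, ← LinearMap.comp_apply]
  exact LinearMap.congr_fun (LinearMap.pi_ext' fun i => LinearMap.ext_ring (congrFun h i)) c

theorem isMatlisReflexive_ext_of_finite_left [IsNoetherianRing R] [Module.Finite R X]
    (hY : IsMatlisReflexive R Y) (n : ℕ) : IsMatlisReflexive R (ExtMod R X Y n) := by
  induction n generalizing X with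
  | zero => exact hY.hom_of_finite.of_equiv (extZeroEquiv X Y).symm
  | succ n ih =>
    obtain ⟨m, f, hf⟩ := Module.Finite.exists_fin' R X
    obtain ⟨δ, -, hδ⟩ := exists_ext_connecting_left Y (LinearMap.ker f).injective_subtype
      (LinearMap.exact_subtype_ker_map f) hf n
    have := subsingleton_ext_of_projective (R := R) (Fin m → R) Y n
    exact (ih (X := LinearMap.ker f)).of_surjective δ fun x =>
      (hδ x).mp (Subsingleton.elim _ _)

theorem isMatlisReflexive_ext_of_isArtinian_right [IsNoetherianRing R] [IsArtinian R Y]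
    (hX : IsMatlisReflexive R X) (n : ℕ) : IsMatlisReflexive R (ExtMod R X Y n) := by
  induction n generalizing Y with
  | zero =>
    obtain ⟨m, f, hf⟩ := exists_injective_of_isArtinian (R := R) Y
    refine IsMatlisReflexive.of_equiv ?_ (extZeroEquiv X Y).symm
    refine (hX.dual.fin m).of_injective (B := Fin m → MatlisDual R X)
      (LinearMap.pi fun i => LinearMap.compRight R (LinearMap.proj i ∘ₗ f)) fun φ ψ h => ?_
    refine LinearMap.ext fun x => hf (funext fun i => ?_)
    exact LinearMap.congr_fun (congrFun h i) x
  | succ n ih =>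
    obtain ⟨m, f, hf⟩ := exists_injective_of_isArtinian (R := R) Y
    obtain ⟨δ, -, hδ⟩ := exists_ext_connecting_right X hf
      (LinearMap.exact_map_mkQ_range f) (LinearMap.range f).mkQ_surjective n
    have : Module.Injective R (Fin m → MatlisModule R) := inferInstance
    have := subsingleton_ext_of_injective (R := R) X (Fin m → MatlisModule R) n
    exact (ih (Y := (Fin m → MatlisModule R) ⧸ LinearMap.range f)).of_surjective δ fun x =>
      (hδ x).mp (Subsingleton.elim _ _)

end Devissage

end MatlisExt

namespace MatlisExt

open IsLocalRing CategoryTheory TensorProduct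

/-! ### Tor from the canonical free resolution -/

section Tor

variable {R : Type u} [CommRing R]

/-- The free module on the elements of `K` mapping onto `K`. -/
noncomputable def freeCover (R : Type u) [CommRing R] (K : Type u) [AddCommGroup K] [Module R K] :
    (K →₀ R) →ₗ[R] K :=
  Finsupp.linearCombination R id

theorem freeCover_surjective (K : Type u) [AddCommGroup K] [Module R K] :
    Function.Surjective (freeCover R K) := fun x => ⟨Finsupp.single x 1, by
  rw [freeCover, Finsupp.linearCombination_single, one_smul, id]⟩

/-- The syzygy modules of the canonical free resolution of `A`. -/
noncomputable def syzygy (A : ModuleCat.{u} R) : ℕ → ModuleCat.{u} R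
  | 0 => A
  | n + 1 => ModuleCat.of R (LinearMap.ker (freeCover R (syzygy A n)))

variable (A : ModuleCat.{u} R)

/-- The inclusion of a syzygy module into the preceding free module. -/
noncomputable def syzygyInclusion (n : ℕ) : syzygy A (n + 1) →ₗ[R] (syzygy A n →₀ R) :=
  (LinearMap.ker (freeCover R (syzygy A n))).subtype

theorem syzygyInclusion_injective (n : ℕ) : Function.Injective (syzygyInclusion A n) :=
  Submodule.injective_subtype _

theorem syzygyInclusion_exact (n : ℕ) :
    Function.Exact (syzygyInclusion A n) (freeCover R (syzygy A n)) :=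
  LinearMap.exact_subtype_ker_map _

/-- The module `Tor_n(A, Y)`, computed by the canonical free resolution of `A`. -/
noncomputable def torModule (Y : Type u) [AddCommGroup Y] [Module R Y] :
    (n : ℕ) → Submodule R (syzygy A n ⊗[R] Y)
  | 0 => ⊤
  | n + 1 => LinearMap.ker ((syzygyInclusion A n).rTensor Y)

variable {Y₁ Y₂ Y₃ : Type u} [AddCommGroup Y₁] [Module R Y₁] [AddCommGroup Y₂] [Module R Y₂]
  [AddCommGroup Y₃] [Module R Y₃]

theorem rTensor_lTensor_apply {K F : Type*} [AddCommGroup K] [Module R K] [AddCommGroup F]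
    [Module R F] (i : K →ₗ[R] F) (f : Y₁ →ₗ[R] Y₂) (t : K ⊗[R] Y₁) :
    i.rTensor Y₂ (f.lTensor K t) = f.lTensor F (i.rTensor Y₁ t) := by
  rw [← LinearMap.comp_apply, ← LinearMap.comp_apply, LinearMap.rTensor_comp_lTensor,
    LinearMap.lTensor_comp_rTensor]

theorem lTensor_mem_torModule (f : Y₁ →ₗ[R] Y₂) (n : ℕ) {t : syzygy A n ⊗[R] Y₁}
    (ht : t ∈ torModule A Y₁ n) : f.lTensor _ t ∈ torModule A Y₂ n := by
  cases n with
  | zero => trivial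
  | succ n =>
    change (syzygyInclusion A n).rTensor Y₂ _ = 0
    have ht' : (syzygyInclusion A n).rTensor Y₁ t = 0 := ht
    rw [rTensor_lTensor_apply, ht', map_zero]

variable {A} {f : Y₁ →ₗ[R] Y₂} {g : Y₂ →ₗ[R] Y₃}

/-- Tensoring f with a free module keeps it injective, so an element killed by f already vanishes in
the free module tensored with Y₁. -/
theorem ker_lTensor_le_torModule (hf : Function.Injective f) (n : ℕ) :
    LinearMap.ker (f.lTensor (syzygy A n)) ≤ torModule A Y₁ n := by
  cases n with
  | zero => exact le_top
  | succ n =>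
    intro t ht
    have ht' : f.lTensor _ t = 0 := ht
    refine Module.Flat.lTensor_preserves_injective_linearMap (M := syzygy A n →₀ R) f hf ?_
    rw [← rTensor_lTensor_apply, ht', map_zero, map_zero]

theorem exists_mem_torModule_of_lTensor_eq_zero (hf : Function.Injective f)
    (hfg : Function.Exact f g) (hg : Function.Surjective g) (n : ℕ) {t : syzygy A n ⊗[R] Y₂}
    (ht : t ∈ torModule A Y₂ n) (h0 : g.lTensor _ t = 0) :
    ∃ s ∈ torModule A Y₁ n, f.lTensor _ s = t := by
  obtain ⟨s, rfl⟩ := (lTensor_exact (syzygy A n) hfg hg t).mp h0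
  refine ⟨s, ?_, rfl⟩
  cases n with
  | zero => trivial
  | succ n =>
    refine Module.Flat.lTensor_preserves_injective_linearMap (M := syzygy A n →₀ R) f hf ?_
    have ht' : (syzygyInclusion A n).rTensor Y₂ (f.lTensor _ s) = 0 := ht
    rw [← rTensor_lTensor_apply, ht', map_zero]

/-- The snake lemma for i tensored with Y₁ → Y₂ → Y₃; flatness of F makes the row of F left exact,
and the cokernel over Y₁ is Q ⊗ Y₁. -/
theorem exists_connecting_of_flat {K F Q : Type u} [AddCommGroup K] [Module R K] [AddCommGroup F]
    [Module R F] [AddCommGroup Q] [Module R Q] [Module.Flat R F] {i : K →ₗ[R] F} {p : F →ₗ[R] Q}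
    (hip : Function.Exact i p) (hp : Function.Surjective p) (hf : Function.Injective f)
    (hfg : Function.Exact f g) (hg : Function.Surjective g) :
    ∃ δ : LinearMap.ker (i.rTensor Y₃) →ₗ[R] Q ⊗[R] Y₁,
      LinearMap.range δ = LinearMap.ker (f.lTensor Q) ∧
      (LinearMap.ker (i.rTensor Y₂) = ⊥ → Function.Injective δ) := by
  have c₁ : f.lTensor F ∘ₗ i.rTensor Y₁ = i.rTensor Y₂ ∘ₗ f.lTensor K :=
    LinearMap.ext fun t => (rTensor_lTensor_apply i f t).symm
  have c₂ : g.lTensor F ∘ₗ i.rTensor Y₂ = i.rTensor Y₃ ∘ₗ g.lTensor K :=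
    LinearMap.ext fun t => (rTensor_lTensor_apply i g t).symm
  have e₁ := lTensor_exact K hfg hg
  have e₂ := lTensor_exact F hfg hg
  have e₃ := rTensor_exact Y₁ hip hp
  have e₄ := rTensor_exact Y₂ hip hp
  have s₁ := LinearMap.lTensor_surjective K hg
  have s₂ := Module.Flat.lTensor_preserves_injective_linearMap (M := F) f hf
  have k₃ := LinearMap.exact_subtype_ker_map (i.rTensor Y₃)
  have k₂ := LinearMap.exact_subtype_ker_map (i.rTensor Y₂)
  let δ := SnakeLemma.δ' _ _ _ _ _ e₁ _ _ e₂ c₁ c₂ _ k₃ _ e₃ s₁ s₂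
  have h1 : Function.Exact δ (f.lTensor Q) :=
    SnakeLemma.exact_δ'_left _ _ _ _ _ e₁ _ _ e₂ c₁ c₂ _ k₃ _ e₃ _ e₄ s₁ s₂ _
      (LinearMap.ext fun t => (rTensor_lTensor_apply p f t).symm)
      (LinearMap.rTensor_surjective _ hp)
  refine ⟨δ, h1.linearMap_ker_eq.symm, fun h => ?_⟩
  have hF : ∀ t ∈ LinearMap.ker (i.rTensor Y₂), g.lTensor _ t ∈ LinearMap.ker (i.rTensor Y₃) := by
    intro t ht
    rw [LinearMap.mem_ker] at ht ⊢
    rw [rTensor_lTensor_apply, ht, map_zero]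
  have h2 : Function.Exact ((g.lTensor K).restrict hF) δ :=
    SnakeLemma.exact_δ'_right _ _ _ _ _ e₁ _ _ e₂ c₁ c₂ _ k₂ _ k₃ _ e₃ s₁ s₂ _
      (LinearMap.ext fun t => rfl) (Submodule.injective_subtype _)
  rw [injective_iff_map_eq_zero]
  intro x hx
  obtain ⟨y, rfl⟩ := (h2 x).mp hx
  have hy : y = 0 := Subtype.ext ((Submodule.eq_bot_iff _).mp h y y.2)
  rw [hy, map_zero]

theorem exists_tor_connecting (A : ModuleCat.{u} R) (hf : Function.Injective f)
    (hfg : Function.Exact f g) (hg : Function.Surjective g) (n : ℕ) :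
    ∃ δ : torModule A Y₃ (n + 1) →ₗ[R] syzygy A n ⊗[R] Y₁,
      LinearMap.range δ = LinearMap.ker (f.lTensor (syzygy A n)) ∧
      (torModule A Y₂ (n + 1) = ⊥ → Function.Injective δ) :=
  exists_connecting_of_flat (syzygyInclusion_exact A n) (freeCover_surjective _) hf hfg hg

end Tor

end MatlisExt

namespace MatlisExt

open IsLocalRing CategoryTheory TensorProduct

/-! ### Tor of an artinian and a mini-max module is artinian -/

section TorArtinian

variable {R : Type u} [CommRing R] (A : ModuleCat.{u} R)

variable {Y Y₁ Y₂ Y₃ : Type u} [AddCommGroup Y] [Module R Y] [AddCommGroup Y₁] [Module R Y₁]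
  [AddCommGroup Y₂] [Module R Y₂] [AddCommGroup Y₃] [Module R Y₃]

/-- Functoriality of `torModule` in the second variable. -/
noncomputable def torMap (f : Y₁ →ₗ[R] Y₂) (n : ℕ) : torModule A Y₁ n →ₗ[R] torModule A Y₂ n :=
  (f.lTensor _).restrict fun _ ht => lTensor_mem_torModule A f n ht

theorem torMap_exact {f : Y₁ →ₗ[R] Y₂} {g : Y₂ →ₗ[R] Y₃} (hf : Function.Injective f)
    (hfg : Function.Exact f g) (hg : Function.Surjective g) (n : ℕ) :
    Function.Exact (torMap A f n) (torMap A g n) := by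
  intro t
  constructor
  · intro h
    obtain ⟨s, hs, hst⟩ := exists_mem_torModule_of_lTensor_eq_zero hf hfg hg n t.2
      (congrArg Subtype.val h)
    exact ⟨⟨s, hs⟩, Subtype.ext hst⟩
  · rintro ⟨s, rfl⟩
    refine Subtype.ext ?_
    exact (lTensor_exact (syzygy A n) hfg hg _).mpr ⟨s, rfl⟩

theorem isArtinian_torModule_of_exact {f : Y₁ →ₗ[R] Y₂} {g : Y₂ →ₗ[R] Y₃}
    (hf : Function.Injective f) (hfg : Function.Exact f g) (hg : Function.Surjective g) (n : ℕ)
    [IsArtinian R (torModule A Y₁ n)] [IsArtinian R (torModule A Y₃ n)] :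
    IsArtinian R (torModule A Y₂ n) :=
  isArtinian_of_range_eq_ker _ _ (torMap_exact A hf hfg hg n).linearMap_ker_eq.symm

theorem torModule_succ_eq_bot [Module.Flat R Y] (n : ℕ) : torModule A Y (n + 1) = ⊥ := by
  have h := Module.Flat.rTensor_preserves_injective_linearMap (M := Y) _
    (syzygyInclusion_injective A n)
  exact LinearMap.ker_eq_bot_of_injective h

/-- Dimension shifting in Y: for a finite free cover g of Y, the connecting map embeds Tor_(n+1)(A,
Y) in Tor_n(A, ker g). -/
theorem isArtinian_torModule_of_finite [IsNoetherianRing R] [IsArtinian R A] (n : ℕ) :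
    ∀ (Y : Type u) [AddCommGroup Y] [Module R Y] [Module.Finite R Y],
      IsArtinian R (torModule A Y n) := by
  induction n with
  | zero =>
    intro Y _ _ _
    obtain ⟨m, g, hg⟩ := Module.Finite.exists_fin' R Y
    have h1 : IsArtinian R (A ⊗[R] (Fin m → R)) :=
      isArtinian_of_linearEquiv (TensorProduct.piScalarRight R R A (Fin m)).symm
    have h2 : IsArtinian R (A ⊗[R] Y) :=
      isArtinian_of_surjective _ (g.lTensor A) (LinearMap.lTensor_surjective A hg)
    exact isArtinian_of_linearEquiv (Submodule.topEquiv (R := R) (M := A ⊗[R] Y)).symm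
  | succ n ih =>
    intro Y _ _ _
    obtain ⟨m, g, hg⟩ := Module.Finite.exists_fin' R Y
    have hf := (LinearMap.ker g).injective_subtype
    obtain ⟨δ, hδ, hinj⟩ :=
      exists_tor_connecting A hf (LinearMap.exact_subtype_ker_map g) hg n
    have h1 := ih (LinearMap.ker g)
    have h2 : ∀ t, δ t ∈ torModule A (LinearMap.ker g) n := fun t =>
      ker_lTensor_le_torModule hf n (hδ ▸ LinearMap.mem_range_self δ t)
    refine isArtinian_of_injective (δ.codRestrict _ h2) fun x y h => ?_
    exact hinj (torModule_succ_eq_bot A n) (congrArg Subtype.val h)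

theorem lTensor_lsmul_apply {K : Type*} [AddCommGroup K] [Module R K] (a : R) (t : K ⊗[R] Y) :
    (LinearMap.lsmul R Y a).lTensor K t = a • t := by
  have : LinearMap.lsmul R Y a = a • LinearMap.id := LinearMap.ext fun y => rfl
  rw [this, LinearMap.lTensor_smul, LinearMap.lTensor_id, LinearMap.smul_apply, LinearMap.id_apply]

theorem isArtinian_submodule_of_map {T P : Type*} [AddCommGroup T] [Module R T] [AddCommGroup P]
    [Module R P] (φ : T →ₗ[R] P) (K : Submodule R T) (Z : Submodule R P) (W : Submodule R T)
    (h₁ : ∀ t ∈ K, φ t ∈ Z) (h₂ : ∀ t ∈ K, φ t = 0 → t ∈ W) [IsArtinian R Z] [IsArtinian R W] :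
    IsArtinian R K := by
  let ψ : K →ₗ[R] Z := φ.restrict h₁
  have h : IsArtinian R (LinearMap.ker ψ) :=
    isArtinian_of_injective ((K.subtype ∘ₗ (LinearMap.ker ψ).subtype).codRestrict W
      fun t => h₂ _ t.1.2 (congrArg Subtype.val (LinearMap.mem_ker.mp t.2))) fun x y h => by
        have h' := congrArg Subtype.val h
        exact Subtype.ext (Subtype.ext h')
  exact isArtinian_of_range_eq_ker (LinearMap.ker ψ).subtype ψ (Submodule.range_subtype _)

/-- Factor multiplication by a as Y → aY → Y. An a-torsion class maps into the kernel of Tor_n(aY) →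
Tor_n(Y), an image of Tor_(n+1)(Y/aY); classes dying in Tor_n(aY) come from Tor_n of the a-torsion
of Y. -/
theorem isArtinian_torsionBy_torModule (a : R) (n : ℕ)
    [IsArtinian R (torModule A (Submodule.torsionBy R Y a) n)]
    [IsArtinian R (torModule A (Y ⧸ LinearMap.range (LinearMap.lsmul R Y a)) (n + 1))] :
    IsArtinian R (Submodule.torsionBy R (torModule A Y n) a) := by
  let p := (LinearMap.lsmul R Y a).rangeRestrict
  let ι := (LinearMap.range (LinearMap.lsmul R Y a)).subtype
  let j := (Submodule.torsionBy R Y a).subtype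
  have hp : Function.Surjective p := LinearMap.surjective_rangeRestrict _
  have hj : Function.Injective j := Submodule.injective_subtype _
  have hjp : Function.Exact j p := by
    intro y
    simp only [j, Submodule.coe_subtype, Subtype.range_coe_subtype]
    exact Subtype.ext_iff
  obtain ⟨δ, hδ, -⟩ := exists_tor_connecting A (Submodule.injective_subtype _)
    (LinearMap.exact_subtype_mkQ (LinearMap.range (LinearMap.lsmul R Y a)))
    (Submodule.mkQ_surjective _) n
  have h1 : IsArtinian R (LinearMap.ker (ι.lTensor (syzygy A n))) :=
    hδ ▸ isArtinian_of_surjective _ δ.rangeRestrict δ.surjective_rangeRestrict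
  have h2 : IsArtinian R (LinearMap.range (torMap A j n)) :=
    isArtinian_of_surjective _ _ (torMap A j n).surjective_rangeRestrict
  refine isArtinian_submodule_of_map (p.lTensor (syzygy A n) ∘ₗ (torModule A Y n).subtype) _
    (LinearMap.ker (ι.lTensor (syzygy A n))) (LinearMap.range (torMap A j n)) (fun t ht => ?_)
    (fun t _ h => (torMap_exact A hj hjp hp n _).mp (Subtype.ext h))
  rw [LinearMap.mem_ker]
  change ι.lTensor _ (p.lTensor _ _) = 0
  rw [← LinearMap.lTensor_comp_apply]
  exact (lTensor_lsmul_apply a _).trans (congrArg Subtype.val ht)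

theorem exists_pow_smul_torModule_eq_zero {a : R} (h : ∀ y : Y, ∃ k, a ^ k • y = 0) (n : ℕ)
    (t : torModule A Y n) : ∃ k, a ^ k • t = 0 := by
  obtain ⟨t, ht⟩ := t
  have : ∃ k, a ^ k • t = 0 := by
    clear ht
    induction t with
    | zero => exact ⟨0, smul_zero _⟩
    | tmul x y =>
      obtain ⟨k, hk⟩ := h y
      exact ⟨k, by rw [← TensorProduct.tmul_smul, hk, TensorProduct.tmul_zero]⟩
    | add x y hx hy =>
      obtain ⟨k, hk⟩ := hx
      obtain ⟨l, hl⟩ := hy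
      refine ⟨k + l, ?_⟩
      rw [smul_add, pow_add, mul_smul, mul_smul, hl, smul_zero, add_zero, smul_comm, hk, smul_zero]
  obtain ⟨k, hk⟩ := this
  exact ⟨k, Subtype.ext hk⟩

variable [IsLocalRing R] [IsNoetherianRing R]

/-- Induction on the number of elements that generate the maximal ideal modulo J. With none left, Y
is killed by the maximal ideal and hence finite. Otherwise the a-torsion of Y and Y/aY are killed by
J + (a), so Tor has artinian a-torsion; it is also a-power torsion, hence artinian. -/
theorem isArtinian_torModule_of_le_sup [IsArtinian R A] (s : Finset R) :
    ∀ (_ : ∀ a ∈ s, a ∈ maximalIdeal R) (J : Ideal R)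
      (_ : maximalIdeal R ≤ J ⊔ Ideal.span s) (Y : Type u) [AddCommGroup Y] [Module R Y]
      [IsArtinian R Y] (_ : ∀ r ∈ J, ∀ y : Y, r • y = 0) (n : ℕ),
      IsArtinian R (torModule A Y n) := by
  classical
  induction s using Finset.induction_on with
  | empty =>
    intro _ J hJ Y _ _ _ hY n
    rw [Finset.coe_empty, Ideal.span_empty, sup_bot_eq] at hJ
    have := (finite_iff_isArtinian_of_smul_eq_zero (M := Y) fun r hr => hY r (hJ hr)).mpr
      inferInstance
    exact isArtinian_torModule_of_finite A n Y
  | insert a s _ ih =>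
    intro hs J hJ Y _ _ _ hY n
    have hJ' : maximalIdeal R ≤ (J ⊔ Ideal.span {a}) ⊔ Ideal.span s := by
      rwa [Finset.coe_insert, Ideal.span_insert, ← sup_assoc] at hJ
    have hs' : ∀ b ∈ s, b ∈ maximalIdeal R := fun b hb => hs b (Finset.mem_insert_of_mem hb)
    have key : ∀ (Z : Type u) [AddCommGroup Z] [Module R Z], (∀ r ∈ J, ∀ z : Z, r • z = 0) →
        (∀ z : Z, a • z = 0) → ∀ r ∈ J ⊔ Ideal.span {a}, ∀ z : Z, r • z = 0 := by
      intro Z _ _ h1 h2 r hr z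
      obtain ⟨b, hb, c, hc, rfl⟩ := Submodule.mem_sup.mp hr
      obtain ⟨d, rfl⟩ := Ideal.mem_span_singleton'.mp hc
      rw [add_smul, h1 b hb, mul_smul, h2, smul_zero, add_zero]
    have h0 := ih hs' _ hJ' (Submodule.torsionBy R Y a)
      (key _ (fun r hr z => Subtype.ext (hY r hr z)) (fun z => Subtype.ext z.2)) n
    have h2 := ih hs' _ hJ' (Y ⧸ LinearMap.range (LinearMap.lsmul R Y a))
      (key _ (fun r hr z => by
          obtain ⟨y, rfl⟩ := Submodule.mkQ_surjective _ z
          rw [← map_smul, hY r hr, map_zero])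
        (fun z => by
          obtain ⟨y, rfl⟩ := Submodule.mkQ_surjective _ z
          rw [← map_smul]
          exact (Submodule.Quotient.mk_eq_zero _).mpr ⟨y, rfl⟩)) (n + 1)
    have h3 := isArtinian_torsionBy_torModule A (Y := Y) a n
    refine isArtinian_of_torsionBy a (exists_pow_smul_torModule_eq_zero A (fun y => ?_) n)
    obtain ⟨k, hk⟩ := isPowerTorsion_of_isArtinian (R := R) Y y
    exact ⟨k, hk _ (Ideal.pow_mem_pow (hs a (Finset.mem_insert_self a s)) k)⟩

theorem isArtinian_torModule_of_isArtinian [IsArtinian R A] (Y : Type u) [AddCommGroup Y]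
    [Module R Y] [IsArtinian R Y] (n : ℕ) : IsArtinian R (torModule A Y n) := by
  obtain ⟨s, hs⟩ := IsNoetherian.noetherian (maximalIdeal R)
  refine isArtinian_torModule_of_le_sup A s (fun a ha => hs ▸ Submodule.subset_span ha) ⊥ ?_ Y
    (fun r hr y => ?_) n
  · rw [bot_sup_eq]
    exact hs.ge
  · rw [(Submodule.mem_bot R).mp hr, zero_smul]

theorem IsMinimax.isArtinian_torModule [IsArtinian R A] (hY : IsMinimax R Y) (n : ℕ) :
    IsArtinian R (torModule A Y n) := by
  obtain ⟨N, h1, h2⟩ := hY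
  have h3 := isArtinian_torModule_of_finite A n N
  have h4 := isArtinian_torModule_of_isArtinian A (Y ⧸ N) n
  exact isArtinian_torModule_of_exact A N.injective_subtype (LinearMap.exact_subtype_mkQ N)
    N.mkQ_surjective n

end TorArtinian

end MatlisExt

namespace MatlisExt

open IsLocalRing CategoryTheory TensorProduct

/-! ### Ext into a Matlis dual is the dual of Tor -/

section ExtTor

variable {R : Type u} [CommRing R]

theorem nonempty_linearEquiv_of_surjective_of_ker_eq {H P Q : Type*} [AddCommGroup H] [Module R H]
    [AddCommGroup P] [Module R P] [AddCommGroup Q] [Module R Q] {p : H →ₗ[R] P} {q : H →ₗ[R] Q}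
    (hp : Function.Surjective p) (hq : Function.Surjective q)
    (h : LinearMap.ker p = LinearMap.ker q) : Nonempty (P ≃ₗ[R] Q) :=
  ⟨((p.quotKerEquivOfSurjective hp).symm.trans (Submodule.quotEquivOfEq _ _ h)).trans
    (q.quotKerEquivOfSurjective hq)⟩

variable (A : ModuleCat.{u} R) (Z : Type u) [AddCommGroup Z] [Module R Z]

theorem extZeroEquiv_extMapLeft {X X' : Type u} [AddCommGroup X] [Module R X] [AddCommGroup X']
    [Module R X'] (f : X →ₗ[R] X') (e : ExtMod R X' Z 0) :
    extZeroEquiv X Z (extMapLeft Z f 0 e) = extZeroEquiv X' Z e ∘ₗ f := by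
  obtain ⟨φ, rfl⟩ := (extZeroEquiv X' Z).symm.surjective e
  rw [LinearEquiv.apply_symm_apply, ← LinearEquiv.eq_symm_apply]
  exact Abelian.Ext.mk₀_comp_mk₀ (ModuleCat.ofHom f) (ModuleCat.ofHom φ)

theorem nonempty_ext_syzygy_equiv (n j : ℕ) :
    Nonempty (ExtMod R (syzygy A (n + 1)) Z (j + 1) ≃ₗ[R] ExtMod R (syzygy A n) Z (j + 2)) := by
  obtain ⟨δ, h1, h2⟩ := exists_ext_connecting_left Z (syzygyInclusion_injective A n)
    (syzygyInclusion_exact A n) (freeCover_surjective _) (j + 1)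
  have s1 := subsingleton_ext_of_projective (R := R) (syzygy A n →₀ R) Z j
  have s2 := subsingleton_ext_of_projective (R := R) (syzygy A n →₀ R) Z (j + 1)
  refine ⟨LinearEquiv.ofBijective δ ⟨?_, fun y => (h2 y).mp (Subsingleton.elim _ _)⟩⟩
  rw [injective_iff_map_eq_zero]
  intro x hx
  obtain ⟨y, rfl⟩ := (h1 x).mp hx
  rw [Subsingleton.elim y 0, map_zero]

theorem nonempty_ext_equiv_ext_syzygy (n : ℕ) :
    ∀ j k, k = n + j + 1 →
      Nonempty (ExtMod R (syzygy A n) Z (j + 1) ≃ₗ[R] ExtMod R A Z k) := by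
  induction n with
  | zero =>
    rintro j k rfl
    rw [zero_add]
    exact ⟨LinearEquiv.refl R _⟩
  | succ n ih =>
    rintro j k rfl
    obtain ⟨e⟩ := nonempty_ext_syzygy_equiv A Z n j
    obtain ⟨e'⟩ := ih (j + 1) (n + 1 + j + 1) (by omega)
    exact ⟨e.trans e'⟩

theorem exists_surjective_hom_ext_one (n : ℕ) :
    ∃ q : (syzygy A (n + 1) →ₗ[R] Z) →ₗ[R] ExtMod R (syzygy A n) Z 1,
      Function.Surjective q ∧
        LinearMap.ker q = LinearMap.range (LinearMap.lcomp R Z (syzygyInclusion A n)) := by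
  obtain ⟨δ, h1, h2⟩ := exists_ext_connecting_left Z (syzygyInclusion_injective A n)
    (syzygyInclusion_exact A n) (freeCover_surjective _) 0
  have s := subsingleton_ext_of_projective (R := R) (syzygy A n →₀ R) Z 0
  have hδ : Function.Surjective δ := fun y => (h2 y).mp (Subsingleton.elim _ _)
  refine ⟨δ ∘ₗ (extZeroEquiv (syzygy A (n + 1)) Z).symm.toLinearMap,
    hδ.comp (LinearEquiv.surjective _), ?_⟩
  ext φ
  constructor
  · intro hφ
    obtain ⟨e, he⟩ := (h1 _).mp hφ
    refine ⟨extZeroEquiv _ Z e, ?_⟩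
    rw [LinearMap.lcomp_apply', ← extZeroEquiv_extMapLeft, he]
    exact LinearEquiv.apply_symm_apply _ _
  · rintro ⟨ψ, rfl⟩
    refine (h1 _).mpr ⟨(extZeroEquiv _ Z).symm ψ, ?_⟩
    refine (LinearEquiv.eq_symm_apply _).mpr ?_
    rw [extZeroEquiv_extMapLeft, LinearEquiv.apply_symm_apply, LinearMap.lcomp_apply']

variable [IsLocalRing R] (Y : Type u) [AddCommGroup Y] [Module R Y]

/-- The adjunction isomorphism `Hom(K, Y^∨) ≃ (K ⊗ Y)^∨`. -/
noncomputable def homDualEquiv (K : Type u) [AddCommGroup K] [Module R K] :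
    (K →ₗ[R] MatlisDual R Y) ≃ₗ[R] MatlisDual R (K ⊗[R] Y) :=
  TensorProduct.lift.equiv (RingHom.id R) K Y (MatlisModule R)

theorem dualMap_rTensor_homDualEquiv {K F : Type u} [AddCommGroup K] [Module R K] [AddCommGroup F]
    [Module R F] (i : K →ₗ[R] F) (ψ : F →ₗ[R] MatlisDual R Y) :
    dualMap (i.rTensor Y) (homDualEquiv Y F ψ) = homDualEquiv Y K (ψ ∘ₗ i) :=
  TensorProduct.ext' fun _ _ => rfl

theorem exists_surjective_hom_dual_ker {K F : Type u} [AddCommGroup K] [Module R K]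
    [AddCommGroup F] [Module R F] (i : K →ₗ[R] F) :
    ∃ p : (K →ₗ[R] MatlisDual R Y) →ₗ[R] MatlisDual R (LinearMap.ker (i.rTensor Y)),
      Function.Surjective p ∧
        LinearMap.ker p = LinearMap.range (LinearMap.lcomp R (MatlisDual R Y) i) := by
  have hd := dualMap_exact (LinearMap.exact_subtype_ker_map (i.rTensor Y))
  refine ⟨dualMap (LinearMap.ker (i.rTensor Y)).subtype ∘ₗ (homDualEquiv Y K).toLinearMap,
    (dualMap_surjective (Submodule.injective_subtype _)).comp (LinearEquiv.surjective _), ?_⟩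
  ext φ
  constructor
  · intro hφ
    obtain ⟨ψ, hψ⟩ := (hd _).mp hφ
    obtain ⟨χ, rfl⟩ := (homDualEquiv Y F).surjective ψ
    exact ⟨χ, (homDualEquiv Y K).injective ((dualMap_rTensor_homDualEquiv Y i χ).symm.trans hψ)⟩
  · rintro ⟨ψ, rfl⟩
    exact (hd _).mpr ⟨homDualEquiv Y F ψ, dualMap_rTensor_homDualEquiv Y i ψ⟩

/-- In positive degree both sides are the cokernel of restriction from the free module to the next
syzygy on Hom(-, DY): for Ext by dimension shifting, for Tor by adjunction and exactness of D. -/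
theorem nonempty_ext_dual_equiv (n : ℕ) :
    Nonempty (ExtMod R A (MatlisDual R Y) n ≃ₗ[R] MatlisDual R (torModule A Y n)) := by
  cases n with
  | zero =>
    let e : (torModule A Y 0) ≃ₗ[R] A ⊗[R] Y := Submodule.topEquiv (R := R) (M := A ⊗[R] Y)
    exact ⟨((extZeroEquiv A (MatlisDual R Y)).trans
      (homDualEquiv Y A)).trans
        (e.symm.congrLeft (MatlisModule R) R)⟩
  | succ n =>
    obtain ⟨e⟩ := nonempty_ext_equiv_ext_syzygy A (MatlisDual R Y) n 0 (n + 1) rfl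
    obtain ⟨q, hq, hker⟩ := exists_surjective_hom_ext_one A (MatlisDual R Y) n
    obtain ⟨p, hp, hker'⟩ := exists_surjective_hom_dual_ker Y (syzygyInclusion A n)
    obtain ⟨e'⟩ := nonempty_linearEquiv_of_surjective_of_ker_eq hq hp (hker.trans hker'.symm)
    exact ⟨e.symm.trans e'⟩

end ExtTor

/-! ### Ext from an artinian module into a reflexive one -/

section

variable {R : Type u} [CommRing R] [IsLocalRing R] [IsNoetherianRing R]
variable {A X Y : Type u} [AddCommGroup A] [Module R A] [IsArtinian R A]
  [AddCommGroup X] [Module R X] [AddCommGroup Y] [Module R Y]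

/-- The alternative in `h` covers both uses: a reflexive target, where I kills Y, and a reflexive
artinian source, where I kills A. -/
theorem isMatlisReflexive_ext_dual {I : Ideal R} (hI : IsMatlisReflexive R (R ⧸ I))
    (hY : IsMinimax R Y) (h : (∀ r ∈ I, ∀ a : A, r • a = 0) ∨ ∀ r ∈ I, ∀ y : Y, r • y = 0)
    (n : ℕ) : IsMatlisReflexive R (ExtMod R A (MatlisDual R Y) n) := by
  obtain ⟨e⟩ := nonempty_ext_dual_equiv (ModuleCat.of R A) Y n
  have hA : IsArtinian R (ModuleCat.of R A) := ‹IsArtinian R A›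
  have hT := hY.isArtinian_torModule (ModuleCat.of R A) n
  have hE : ∀ r ∈ I, ∀ x : ExtMod R A (MatlisDual R Y) n, r • x = 0 := by
    intro r hr x
    rcases h with h | h
    · exact ext_smul_eq_zero_of_left _ _ (h r hr) n x
    · refine ext_smul_eq_zero_of_right _ _ (fun φ => LinearMap.ext fun y => ?_) n x
      rw [LinearMap.smul_apply, ← map_smul, h r hr, map_zero, LinearMap.zero_apply]
  -- I kills Ext, which is the dual of Tor, so it kills Tor because E separates points.
  have hD : ∀ r ∈ I, ∀ t : torModule (ModuleCat.of R A) Y n, r • t = 0 := by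
    intro r hr t
    refine eq_zero_of_forall_dual (R := R) fun φ => ?_
    obtain ⟨x, rfl⟩ := e.surjective φ
    rw [map_smul, ← LinearMap.smul_apply, ← map_smul, hE r hr, map_zero, LinearMap.zero_apply]
  exact (IsMatlisReflexive.of_isArtinian hI hD).dual.of_equiv e.symm

theorem isMatlisReflexive_ext_of_isArtinian_left (hX : IsMatlisReflexive R X) (n : ℕ) :
    IsMatlisReflexive R (ExtMod R A X n) := by
  refine (isMatlisReflexive_ext_dual hX.quotient_annihilator hX.dual.isMinimax (Or.inr ?_)
    n).of_equiv (extCongrRight A (LinearEquiv.ofBijective _ hX).symm n)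
  intro r hr φ
  refine LinearMap.ext fun x => ?_
  rw [LinearMap.smul_apply, ← map_smul, Module.mem_annihilator.mp hr, map_zero,
    LinearMap.zero_apply]

end

end MatlisExt

namespace MatlisExt

open IsLocalRing CategoryTheory

/-! ### Consequences of vanishing Ext -/

section ExtVanishing

variable {R : Type u} [CommRing R]
variable (X : Type u) [AddCommGroup X] [Module R X]
variable {A B C : Type u} [AddCommGroup A] [Module R A] [AddCommGroup B] [Module R B]
  [AddCommGroup C] [Module R C]

theorem subsingleton_ext_of_subsingleton [Subsingleton A] (n : ℕ) :
    Subsingleton (ExtMod R X A n) := by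
  refine subsingleton_of_forall_eq 0 fun e => ?_
  rw [← one_smul R e]
  exact ext_smul_eq_zero_of_right _ _ (fun _ => Subsingleton.elim _ _) n e

variable {f : A →ₗ[R] B} {g : B →ₗ[R] C} (hf : Function.Injective f)
    (hfg : Function.Exact f g) (hg : Function.Surjective g)

include hf hfg hg

theorem extMapRight_injective (h : ∀ n, Subsingleton (ExtMod R X C n)) (n : ℕ) :
    Function.Injective (extMapRight X f n) := by
  cases n with
  | zero => exact extMapRight_zero_injective X hf
  | succ n =>
    obtain ⟨δ, -, h2⟩ := exists_ext_connecting_right X hf hfg hg n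
    rw [injective_iff_map_eq_zero]
    intro x hx
    obtain ⟨y, rfl⟩ := (h2 x).mp hx
    rw [(h n).elim y 0, map_zero]

theorem subsingleton_ext_of_exact {n : ℕ} (hA : Subsingleton (ExtMod R X A n))
    (hC : Subsingleton (ExtMod R X C n)) : Subsingleton (ExtMod R X B n) := by
  refine subsingleton_of_forall_eq 0 fun e => ?_
  obtain ⟨y, rfl⟩ := (extMapRight_exact X hf hfg hg n e).mp (Subsingleton.elim _ _)
  rw [Subsingleton.elim y 0, map_zero]

end ExtVanishing

/-! ### The exact functor M ↦ DDM/M and its Ext from k -/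

section BidualCokernel

variable (R : Type u) [CommRing R] [IsLocalRing R]

/-- The cokernel of the biduality map. -/
abbrev BidualCokernel (M : Type u) [AddCommGroup M] [Module R M] : Type u :=
  MatlisDual R (MatlisDual R M) ⧸ LinearMap.range (biduality R M (MatlisModule R))

variable {R}
variable {A B C : Type u} [AddCommGroup A] [Module R A] [AddCommGroup B] [Module R B]
  [AddCommGroup C] [Module R C]

/-- Functoriality of the cokernel of the biduality map. -/
noncomputable def bidualCokernelMap (f : A →ₗ[R] B) : BidualCokernel R A →ₗ[R] BidualCokernel R B :=
  Submodule.mapQ _ _ (dualMap (dualMap f)) (by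
    rintro _ ⟨a, rfl⟩
    exact ⟨f a, rfl⟩)

theorem bidualCokernelMap_lsmul (r : R) :
    bidualCokernelMap (LinearMap.lsmul R A r) = LinearMap.lsmul R (BidualCokernel R A) r := by
  refine Submodule.linearMap_qext _ (LinearMap.ext fun Φ => ?_)
  refine congrArg (Submodule.Quotient.mk) (LinearMap.ext fun φ => ?_)
  change Φ (φ ∘ₗ LinearMap.lsmul R A r) = r • Φ φ
  rw [← map_smul]
  exact congrArg Φ (LinearMap.ext fun a => map_smul φ r a)

theorem bidualCokernelMap_injective {f : A →ₗ[R] B} (hf : Function.Injective f) :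
    Function.Injective (bidualCokernelMap f) := by
  rw [injective_iff_map_eq_zero]
  intro x hx
  obtain ⟨Φ, rfl⟩ := Submodule.mkQ_surjective _ x
  obtain ⟨b, hb⟩ := (Submodule.Quotient.mk_eq_zero _).mp hx
  obtain ⟨a, rfl⟩ := mem_range_of_dualMap_dualMap_eq hb.symm
  refine (Submodule.Quotient.mk_eq_zero _).mpr ⟨a, ?_⟩
  exact dualMap_injective (dualMap_surjective hf) hb

theorem bidualCokernelMap_exact {f : A →ₗ[R] B} {g : B →ₗ[R] C} (hfg : Function.Exact f g)
    (hg : Function.Surjective g) :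
    Function.Exact (bidualCokernelMap f) (bidualCokernelMap g) := by
  have hd := dualMap_exact (dualMap_exact hfg)
  intro x
  constructor
  · intro hx
    obtain ⟨Φ, rfl⟩ := Submodule.mkQ_surjective _ x
    obtain ⟨c, hc⟩ := (Submodule.Quotient.mk_eq_zero _).mp hx
    obtain ⟨b, rfl⟩ := hg c
    obtain ⟨Ψ, hΨ⟩ := (hd (Φ - biduality R B (MatlisModule R) b)).mp (by
      rw [map_sub, sub_eq_zero]
      exact hc.symm)
    refine ⟨Submodule.mkQ _ Ψ, (Submodule.Quotient.eq _).mpr ?_⟩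
    rw [hΨ, sub_sub_cancel_left]
    exact neg_mem (LinearMap.mem_range_self _ b)
  · rintro ⟨y, rfl⟩
    obtain ⟨Ψ, rfl⟩ := Submodule.mkQ_surjective _ y
    exact congrArg (Submodule.mkQ _) ((hd _).mpr ⟨Ψ, rfl⟩)

theorem bidualCokernelMap_surjective {g : B →ₗ[R] C} (hg : Function.Surjective g) :
    Function.Surjective (bidualCokernelMap g) := fun x => by
  obtain ⟨Φ, rfl⟩ := Submodule.mkQ_surjective _ x
  obtain ⟨Ψ, rfl⟩ := dualMap_surjective (dualMap_injective hg) Φ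
  exact ⟨Submodule.mkQ _ Ψ, rfl⟩

theorem IsMatlisReflexive.subsingleton_bidualCokernel (hA : IsMatlisReflexive R A) :
    Subsingleton (BidualCokernel R A) :=
  Submodule.Quotient.subsingleton_iff.mpr (LinearMap.range_eq_top.mpr hA.2)

variable [IsNoetherianRing R]

/-- Write C(M) = DDM/M, an exact functor of M. If the maximal ideal kills M, then C(M) = 0.
Otherwise some r in it acts nontrivially on M. If r is not injective on M, then rM and M/rM are both
smaller quotients. If it is injective, Ext(k, C(M/rM)) = 0 makes r injective on Ext(k, C(M)), where
it acts as zero. -/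
theorem subsingleton_ext_residueField_bidualCokernel (N : Type u) [AddCommGroup N] [Module R N]
    [Module.Finite R N] (n : ℕ) :
    Subsingleton (ExtMod R (ResidueField R) (BidualCokernel R N) n) := by
  -- Quotients of N are indexed by their kernels, so that the induction runs over the submodules of
  -- the one noetherian module N.
  suffices H : ∀ (U : Submodule R N) (M : Type u) [AddCommGroup M] [Module R M] (π : N →ₗ[R] M)
      (_ : Function.Surjective π) (_ : LinearMap.ker π = U) (n : ℕ),
      Subsingleton (ExtMod R (ResidueField R) (BidualCokernel R M) n) from
    H _ N LinearMap.id Function.surjective_id rfl n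
  intro U
  induction U using WellFoundedGT.induction with
  | ind U ih =>
  intro M _ _ π hπ hU n
  have : Module.Finite R M := Module.Finite.of_surjective π hπ
  by_cases h : ∀ r ∈ maximalIdeal R, ∀ x : M, r • x = 0
  · have := ((isMatlisReflexive_iff_finite h).mpr this).subsingleton_bidualCokernel
    exact subsingleton_ext_of_subsingleton _ n
  push Not at h
  obtain ⟨r, hr, x, hx⟩ := h
  let f := LinearMap.lsmul R M r
  let W := LinearMap.range f
  have hW : ∀ n, Subsingleton (ExtMod R (ResidueField R) (BidualCokernel R (M ⧸ W)) n) := by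
    refine fun n => ih _ ?_ (M ⧸ W) (W.mkQ ∘ₗ π) (W.mkQ_surjective.comp hπ) rfl n
    refine lt_of_le_not_ge (hU ▸ LinearMap.ker_le_ker_comp _ _) fun hle => hx ?_
    obtain ⟨y, hy⟩ := hπ (r • x)
    rw [← hy, ← LinearMap.mem_ker, hU]
    refine hle (LinearMap.mem_ker.mpr ((Submodule.Quotient.mk_eq_zero _).mpr ⟨x, ?_⟩))
    exact hy.symm
  by_cases hker : LinearMap.ker f = ⊥
  · have hinj : Function.Injective f := LinearMap.ker_eq_bot.mp hker
    have hex : Function.Exact f W.mkQ := LinearMap.exact_map_mkQ_range f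
    have := extMapRight_injective (ResidueField R) (bidualCokernelMap_injective hinj)
      (bidualCokernelMap_exact hex W.mkQ_surjective)
      (bidualCokernelMap_surjective W.mkQ_surjective) hW n
    rw [injective_iff_map_eq_zero] at this
    refine subsingleton_of_forall_eq 0 fun e => this e ?_
    rw [bidualCokernelMap_lsmul, extMapRight_lsmul]
    refine ext_smul_eq_zero_of_left _ _ (fun c => ?_) n e
    rw [Algebra.smul_def, ResidueField.algebraMap_eq, (residue_eq_zero_iff r).mpr hr, zero_mul]
  · have hW' := ih _ (by
      refine lt_of_le_not_ge (hU ▸ LinearMap.ker_le_ker_comp π f.rangeRestrict) fun hle =>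
        hker ((Submodule.eq_bot_iff _).mpr fun y hy => ?_)
      obtain ⟨z, rfl⟩ := hπ y
      rw [← LinearMap.mem_ker, hU]
      exact hle (Subtype.ext hy)) W (f.rangeRestrict ∘ₗ π)
      (f.surjective_rangeRestrict.comp hπ) rfl n
    exact subsingleton_ext_of_exact _ (bidualCokernelMap_injective W.injective_subtype)
      (bidualCokernelMap_exact (LinearMap.exact_subtype_mkQ W) W.mkQ_surjective)
      (bidualCokernelMap_surjective W.mkQ_surjective) hW' (hW n)

end BidualCokernel

/-! ### From k to power-torsion modules -/

section PowerTorsion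

variable {R : Type u} [CommRing R] [IsLocalRing R]
variable {A C : Type u} [AddCommGroup A] [Module R A] [AddCommGroup C] [Module R C]

theorem eq_zero_of_subsingleton_ext_residueField
    (h : Subsingleton (ExtMod R (ResidueField R) C 0)) {c : C}
    (hc : ∀ r ∈ maximalIdeal R, r • c = 0) : c = 0 := by
  have : Subsingleton (ResidueField R →ₗ[R] C) :=
    (extZeroEquiv (ResidueField R) C).symm.injective.subsingleton
  let φ : (R ⧸ maximalIdeal R) →ₗ[R] C :=
    Submodule.liftQ _ (LinearMap.toSpanSingleton R C c) fun r hr => hc r hr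
  have h1 : φ (Submodule.Quotient.mk 1) = c := one_smul R c
  rw [← h1, show φ = 0 from Subsingleton.elim (α := ResidueField R →ₗ[R] C) _ _,
    LinearMap.zero_apply]

theorem eq_zero_of_forall_pow_smul_eq_zero
    (h : ∀ c : C, (∀ r ∈ maximalIdeal R, r • c = 0) → c = 0) (n : ℕ) :
    ∀ c : C, (∀ r ∈ maximalIdeal R ^ n, r • c = 0) → c = 0 := by
  induction n with
  | zero =>
    intro c hc
    rw [← one_smul R c]
    exact hc 1 (by rw [pow_zero, Ideal.one_eq_top]; trivial)
  | succ n ih =>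
    refine fun c hc => h c fun r hr => ih _ fun s hs => ?_
    rw [smul_smul]
    exact hc _ (pow_succ (maximalIdeal R) n ▸ Ideal.mul_mem_mul hs hr)

/-- Dimension shifting in C. As C has no socle, neither has its injective hull J, by essentiality;
so all Ext(k, J) vanish, J/C inherits the hypothesis, and Ext^(n+1)(A, C) is a quotient of Ext^n(A,
J/C). -/
theorem subsingleton_ext_of_isPowerTorsion (hA : IsPowerTorsion (maximalIdeal R) A) (n : ℕ) :
    ∀ (C : Type u) [AddCommGroup C] [Module R C],
      (∀ j, Subsingleton (ExtMod R (ResidueField R) C j)) → Subsingleton (ExtMod R A C n) := by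
  induction n with
  | zero =>
    intro C _ _ hC
    suffices Subsingleton (A →ₗ[R] C) from (extZeroEquiv A C).injective.subsingleton
    refine subsingleton_of_forall_eq 0 fun φ => LinearMap.ext fun a => ?_
    obtain ⟨k, hk⟩ := hA a
    refine eq_zero_of_forall_pow_smul_eq_zero
      (fun c => eq_zero_of_subsingleton_ext_residueField (hC 0)) k _ fun r hr => ?_
    rw [← map_smul, hk r hr, map_zero]
  | succ n ih =>
    intro C _ _ hC
    let J := injectiveHull R C
    let ι : C →ₗ[R] J := injectiveHullι R C
    obtain ⟨hJ, hι, hess⟩ := isInjectiveHull_injectiveHullι R C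
    have hex : Function.Exact ι (LinearMap.range ι).mkQ := LinearMap.exact_map_mkQ_range ι
    have hsurj := (LinearMap.range ι).mkQ_surjective
    have hJ0 : ∀ j, Subsingleton (ExtMod R (ResidueField R) J j) := by
      rintro (_ | j)
      · suffices Subsingleton (ResidueField R →ₗ[R] J) from
          (extZeroEquiv (ResidueField R) J).injective.subsingleton
        refine subsingleton_of_forall_eq 0 fun φ => LinearMap.ext fun c => ?_
        have h1 : Submodule.torsionBySet R J (maximalIdeal R : Set R) = ⊥ := by
          refine hess _ ((Submodule.eq_bot_iff _).mpr ?_)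
          rintro _ ⟨hx, c, rfl⟩
          rw [eq_zero_of_subsingleton_ext_residueField (hC 0) (c := c) fun r hr => ?_, map_zero]
          refine hι ?_
          rw [map_smul, map_zero]
          exact (Submodule.mem_torsionBySet_iff _ _).mp hx ⟨r, hr⟩
        refine (Submodule.eq_bot_iff _).mp h1 _ ((Submodule.mem_torsionBySet_iff _ _).mpr ?_)
        rintro ⟨r, hr⟩
        change r • φ c = 0
        rw [← map_smul, Algebra.smul_def, ResidueField.algebraMap_eq,
          (residue_eq_zero_iff r).mpr hr, zero_mul, map_zero]
      · exact subsingleton_ext_of_injective _ _ j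
    have hQ : ∀ j, Subsingleton (ExtMod R (ResidueField R) (J ⧸ LinearMap.range ι) j) := by
      intro j
      obtain ⟨δ, h1, -⟩ := exists_ext_connecting_right (ResidueField R) hι hex hsurj j
      refine subsingleton_of_forall_eq 0 fun e => ?_
      obtain ⟨y, rfl⟩ := (h1 e).mp ((hC (j + 1)).elim _ _)
      rw [(hJ0 j).elim y 0, map_zero]
    have hAQ := ih _ hQ
    obtain ⟨δ, -, h2⟩ := exists_ext_connecting_right A hι hex hsurj n
    refine subsingleton_of_forall_eq 0 fun e => ?_
    obtain ⟨y, rfl⟩ := (h2 e).mp ((subsingleton_ext_of_injective A J n).elim _ _)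
    rw [hAQ.elim y 0, map_zero]

end PowerTorsion

/-! ### Assembling the cases -/

section Main

variable {R : Type u} [CommRing R] [IsLocalRing R] [IsNoetherianRing R]
variable {A M N X : Type u} [AddCommGroup A] [Module R A] [AddCommGroup M] [Module R M]
  [AddCommGroup N] [Module R N] [AddCommGroup X] [Module R X]

omit [IsLocalRing R] [IsNoetherianRing R] in
theorem isMinimax_of_isArtinian [IsArtinian R A] : IsMinimax R A :=
  ⟨⊥, inferInstance, inferInstance⟩

/-- N need not be reflexive, so N is replaced by DDN: Ext(A, DDN/N) = 0 embeds Ext(A, N) in Ext(A,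
DDN), which is reflexive because DN is artinian and Ann A kills A. -/
theorem isMatlisReflexive_ext_of_isArtinian_of_finite [IsArtinian R A] [Module.Finite R N]
    (hA : IsMatlisReflexive R A) (n : ℕ) : IsMatlisReflexive R (ExtMod R A N n) := by
  have h1 := isMatlisReflexive_ext_dual (A := A) (Y := MatlisDual R N) hA.quotient_annihilator
    isMinimax_of_isArtinian (Or.inl fun r hr a => Module.mem_annihilator.mp hr a) n
  refine h1.of_injective _ (extMapRight_injective A (biduality_injective (R := R) (M := N))
    (LinearMap.exact_map_mkQ_range _) (Submodule.mkQ_surjective _) (fun j => ?_) n)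
  exact subsingleton_ext_of_isPowerTorsion (isPowerTorsion_of_isArtinian A) j _
    (subsingleton_ext_residueField_bidualCokernel N)

theorem isMatlisReflexive_ext_of_isMinimax_left (hM : IsMinimax R M)
    (hX : IsMatlisReflexive R X) (n : ℕ) : IsMatlisReflexive R (ExtMod R M X n) := by
  obtain ⟨N, h1, h2⟩ := hM
  exact isMatlisReflexive_ext_of_left N n (isMatlisReflexive_ext_of_finite_left hX n)
    (isMatlisReflexive_ext_of_isArtinian_left hX n)

/-- Both pieces of the mini-max filtration of X inherit reflexivity, which supplies an ideal with
reflexive quotient for each. -/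
theorem isMatlisReflexive_ext_of_finite_right [Module.Finite R N] (hX : IsMatlisReflexive R X)
    (n : ℕ) : IsMatlisReflexive R (ExtMod R X N n) := by
  obtain ⟨U, h1, h2⟩ := hX.isMinimax
  have hU : IsMatlisReflexive R U := hX.of_injective U.subtype U.injective_subtype
  have hQ : IsMatlisReflexive R (X ⧸ U) := hX.of_surjective U.mkQ U.mkQ_surjective
  refine isMatlisReflexive_ext_of_left U n ?_ (isMatlisReflexive_ext_of_isArtinian_of_finite hQ n)
  have : Module.Finite R (ExtMod R U N n) := inferInstance
  exact IsMatlisReflexive.of_finite hU.quotient_annihilator fun r hr e =>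
    ext_smul_eq_zero_of_left _ _ (fun x => Module.mem_annihilator.mp hr x) n e

theorem isMatlisReflexive_ext_of_isMinimax_right (hM : IsMinimax R M)
    (hX : IsMatlisReflexive R X) (n : ℕ) : IsMatlisReflexive R (ExtMod R X M n) := by
  obtain ⟨N, h1, h2⟩ := hM
  exact isMatlisReflexive_ext_of_right N n (isMatlisReflexive_ext_of_finite_right hX n)
    (isMatlisReflexive_ext_of_isArtinian_right hX n)

end Main

end MatlisExt

theorem corollary100618 {R : Type u} [CommRing R] [IsNoetherianRing R] [IsLocalRing R]
    (M M' : Type u) [AddCommGroup M] [Module R M] [AddCommGroup M'] [Module R M']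
    (hM : MatlisExt.IsMinimax R M) (hM' : MatlisExt.IsMatlisReflexive R M') (i : ℕ) :
    (MatlisExt.IsMatlisReflexive R
        (CategoryTheory.Abelian.Ext (ModuleCat.of R M) (ModuleCat.of R M') i) ∧
      MatlisExt.IsMatlisReflexiveOverCompletion R
        (CategoryTheory.Abelian.Ext (ModuleCat.of R M) (ModuleCat.of R M') i)) ∧
    (MatlisExt.IsMatlisReflexive R
        (CategoryTheory.Abelian.Ext (ModuleCat.of R M') (ModuleCat.of R M) i) ∧
      MatlisExt.IsMatlisReflexiveOverCompletion R
        (CategoryTheory.Abelian.Ext (ModuleCat.of R M') (ModuleCat.of R M) i)) := by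
  have h1 := MatlisExt.isMatlisReflexive_ext_of_isMinimax_left hM hM' i
  have h2 := MatlisExt.isMatlisReflexive_ext_of_isMinimax_right hM hM' i
  exact ⟨⟨h1, h1.isMatlisReflexiveOverCompletion⟩, h2, h2.isMatlisReflexiveOverCompletion⟩
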